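/- Let $\mathbb T=\mathbb R/\mathbb Z$ and $\mathbb T_n=\mathbb Z/n\mathbb Z$ for $n\in\{1,2,\dots\}$. Fix $\alpha>0$, put $\phi(\rho)=\rho/(1+\rho)$ and $\phi_n(u)=n^\alpha\phi(n^\alpha u)$ for $\rho,u\ge 0$, and for $f:\mathbb T_n\to\mathbb R$ put $\Delta_nf(x)=n^2\big(f(x+1)+f(x-1)-2f(x)\big)$. Let $u_0\in C^2(\mathbb T)$ satisfy $u_0(x)\ge\epsilon$ for all $x\in\mathbb T$, for some $\epsilon>0$. For $S>0$, let $\mathcal H_1(S)$ be the completion of $C^1([0,S]\times\mathbb T)$ under the norm $\big(\int_0^S\int_{\mathbb T}(f^2+(\partial_xf)^2)\,dx\,dt\big)^{1/2}$, regarded as a space of functions $f\in L^2([0,S]\times\mathbb T)$ with weak derivative $\partial_xf\in L^2([0,S]\times\mathbb T)$. A weak solution with finite energy on $[0,S]$ of $$\partial_tu=\partial_x\big(u^{-2}\partial_xu\big),\qquad u(0,\cdot)=u_0,\tag{1}$$ is an almost everywhere positive function $u$ on $[0,S]\times\mathbb T$ such that $u$ and $-u^{-1}$ belong to $\mathcal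 H_1(S)$, with $\partial_x(-u^{-1})=u^{-2}\partial_xu$, and $$\int_{\mathbb T}u_0(x)g(0,x)\,dx+\int_0^S\!\!\int_{\mathbb T}\big(u\,\partial_tg-u^{-2}\partial_xu\,\partial_xg\big)\,dx\,dt=0$$ for every $C^1$ function $g$ with $g(S,\cdot)=0$. Theorem. For each $n\ge1$ the system $$\tfrac{d}{dt}u^n_t(x)=\Delta_n\phi_n(u^n_t(x)),\qquad u^n_0(x)=u_0(\tfrac xn),\qquad t\ge0,\ x\in\mathbb T_n,$$ has a unique non-negative global solution $u^n$. There is a continuous function $u:[0,\infty)\times\mathbb T\to(0,\infty)$ with $u(0,\cdot)=u_0$ which, for every $S>0$, is on $[0,S]$ the unique (up to null sets) weak solution with finite energy of (1). Moreover, there exists $T>0$ such that $$\lim_{n\to\infty}\ \sup_{x\in\mathbb T_n}\ \sup_{0\le t\le T}\big|u^n_t(x)-u(t,\tfrac xn)\big|=0 .$$ -/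

import Mathlib

open MeasureTheory Filter Topology

noncomputable section

namespace FastDiffusion

/-- The function `φ(ρ) = ρ / (1 + ρ)`, used for `ρ ≥ 0`. -/
def phi (ρ : ℝ) : ℝ := ρ / (1 + ρ)

/-- The rescaled nonlinearity `φ_n(u) = n ^ α φ(n ^ α u)`. -/
def phiN (α : ℝ) (n : ℕ+) (u : ℝ) : ℝ :=
  ((n : ℕ) : ℝ) ^ α * phi (((n : ℕ) : ℝ) ^ α * u)

/-- The discrete Laplacian on the discrete circle `ℤ / nℤ`. -/
def discreteLaplacian (n : ℕ+) (f : ZMod n → ℝ) (x : ZMod n) : ℝ :=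
  ((n : ℕ) : ℝ) ^ 2 * (f (x + 1) + f (x - 1) - 2 * f x)

/-- `U` is a global (non-negative) solution on `[0, ∞)` of the system of ODEs
`d/dt U_t(x) = Δ_n φ_n(U_t(x))` on `ℤ / nℤ`, with initial data `U_0(x) = u₀(x / n)`.
Here `ZMod.toAddCircle` is the canonical embedding `x ↦ x / n` of `ℤ / nℤ` into `ℝ / ℤ`,
and the derivative at time `0` is one-sided. -/
structure IsDiscreteSolution (α : ℝ) (u₀ : UnitAddCircle → ℝ) (n : ℕ+)
    (U : ℝ → ZMod n → ℝ) : Prop where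
  nonneg : ∀ t, 0 ≤ t → ∀ x, 0 ≤ U t x
  initial : ∀ x, U 0 x = u₀ (ZMod.toAddCircle x)
  ode : ∀ t, 0 ≤ t → ∀ x, HasDerivWithinAt (fun s => U s x)
    (discreteLaplacian n (fun y => phiN α n (U t y)) x) (Set.Ici 0) t

/-- The measure `dt dx` on `[0, T] × 𝕋`, where `𝕋 = ℝ / ℤ` has total mass one. -/
def spaceTime (T : ℝ) : Measure (ℝ × UnitAddCircle) :=
  (volume.restrict (Set.Icc 0 T)).prod volume

/-- Continuously differentiable functions of time and of a point of the circle. -/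
def IsC1 (g : ℝ → UnitAddCircle → ℝ) : Prop :=
  ContDiff ℝ 1 (fun q : ℝ × ℝ => g q.1 (q.2 : UnitAddCircle))

/-- The time derivative `∂_t g`. -/
def dt (g : ℝ → UnitAddCircle → ℝ) (t : ℝ) (x : UnitAddCircle) : ℝ :=
  deriv (fun s : ℝ => g s x) t

/-- The space derivative `∂_x g` on the circle. -/
def dx (g : ℝ → UnitAddCircle → ℝ) (t : ℝ) (x : UnitAddCircle) : ℝ :=
  deriv (fun h : ℝ => g t (x + (h : UnitAddCircle))) 0

/-- `f` belongs to the energy space `L²(0, T; H¹(𝕋))` with (weak) space derivative `∂_x f = p`.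
The space is the completion of the `C¹` functions for the norm
`(∫₀ᵀ ∫ (f² + (∂_x f)²) dx dt) ^ (1/2)`, realised inside `L²`: the pair `(f, p)` is a limit in
`L² × L²` of pairs `(F k, ∂_x (F k))` with `F k` of class `C¹`. -/
structure HasEnergyDeriv (T : ℝ) (f p : ℝ → UnitAddCircle → ℝ) : Prop where
  memLp_fun : MemLp (Function.uncurry f) 2 (spaceTime T)
  memLp_deriv : MemLp (Function.uncurry p) 2 (spaceTime T)
  approx : ∃ F : ℕ → ℝ → UnitAddCircle → ℝ, (∀ k, IsC1 (F k)) ∧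
    Tendsto (fun k => eLpNorm (fun z => F k z.1 z.2 - f z.1 z.2) 2 (spaceTime T))
      atTop (𝓝 0) ∧
    Tendsto (fun k => eLpNorm (fun z => dx (F k) z.1 z.2 - p z.1 z.2) 2 (spaceTime T))
      atTop (𝓝 0)

/-- `u` is a weak solution with finite energy, on `[0, T] × 𝕋`, of
`∂_t u = ∂_x (u⁻² ∂_x u)`, `u(0, ·) = u₀`: it is positive, `u` and `-1 / u` are in the energy
space with `∂_x (-1 / u) = u⁻² ∂_x u`, and the equation holds when tested against every `C¹`
function that vanishes at time `T`. -/
structure IsEnergySolution (T : ℝ) (u₀ : UnitAddCircle → ℝ) (u : ℝ → UnitAddCircle → ℝ) :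
    Prop where
  pos : ∀ᵐ z ∂(spaceTime T), 0 < u z.1 z.2
  weak : ∃ p : ℝ → UnitAddCircle → ℝ,
    HasEnergyDeriv T u p ∧
    HasEnergyDeriv T (fun t x => -(u t x)⁻¹) (fun t x => ((u t x) ^ 2)⁻¹ * p t x) ∧
    ∀ g : ℝ → UnitAddCircle → ℝ, IsC1 g → (∀ x, g T x = 0) →
      (∫ x, u₀ x * g 0 x) +
        ∫ z, (u z.1 z.2 * dt g z.1 z.2 -
          ((u z.1 z.2) ^ 2)⁻¹ * p z.1 z.2 * dx g z.1 z.2) ∂(spaceTime T) = 0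

end FastDiffusion

end

/-!
The nonlinearity of the discrete system is `φ_n(u) = n ^ α - 1 / (δ + u)` with `δ = n ^ (-α)`
(`phiN_eq`). Hence `V = u^n + δ` solves `∂ₜ V = Δ_n (-1 / V)`, which is the standard space
discretization of the limit equation `∂ₜ u = ∂ₓ² (-1 / u)`; only the initial data are moved by `δ`.

**The continuous equation.** It is linearized by the hodograph transformation
(`isClassicalSolution_of_heat`): let `Y₀(x) = ∫₀ˣ u₀` be the mass coordinate, let `X` solve the heat
equation with initial data `Y₀⁻¹`, and let `Y t` be the inverse function of `X t`. Then
`u = ∂ₓ Y = 1 / ∂_y X (t, Y)` solves the equation for all times. The heat equation is solved by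
averaging over a Gaussian variable (`heat`). As `u₀` is `C²`, the data `Y₀⁻¹` are `C³`, so that
`u`, `∂ₓ u` and `∂ₓ² u` are continuous up to time `0`; bounds on `∂_y X` are kept by averaging, so
`u` is bounded below.

**Uniqueness of energy solutions** (`IsEnergySolution.ae_eq`). For two solutions `u`, `v` the weak
formulation is tested with `g(t, x) = ∫ₜˢ (1 / v - 1 / u)(s, x) ds`. This gives
`∫∫ (u - v)(1 / v - 1 / u) = -½ ∫ (∫₀ˢ ∂ₓ (1 / v - 1 / u) ds)² dx ≤ 0`, while the integrand on the
left is nonnegative. The `C¹` functions approximating `-1 / u` in the definition of the energy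
space make `g` admissible.

**Convergence.** With `W = -1 / (u^n + δ)` and `w = -1 / u` one has `∂ₜ W = W² Δ_n W` and
`∂ₜ w = w² ∂ₓ² w`. The difference satisfies a linear discrete parabolic equation up to a zero order
term and the error `Δ_n w - ∂ₓ² w`, which tends to zero uniformly because `∂ₓ² w` is uniformly
continuous on `[0, T] × 𝕋`. The maximum principle (`le_zero_of_forall_max`) and an exponential
comparison function conclude (`abs_discrete_sub_le`). This works for every `T`.
-/

open ProbabilityTheory

namespace FastDiffusion

/-! ### Gaussian averages and the heat equation -/

/-- The average of `f` around `y` against a centred Gaussian of standard deviation `|r|`. -/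
noncomputable def gaussAvg (f : ℝ → ℝ) (r y : ℝ) : ℝ :=
  ∫ z, f (y + r * z) ∂(gaussianReal 0 1)

theorem integrable_abs_gaussian : Integrable (fun z : ℝ => |z|) (gaussianReal 0 1) :=
  ((memLp_id_gaussianReal (μ := 0) (v := 1) 1).integrable (by simp)).abs

theorem integrable_gauss_of_growth {f : ℝ → ℝ} (hf : Continuous f) {C : ℝ}
    (hC : ∀ x, |f x| ≤ C * (1 + |x|)) (r y : ℝ) :
    Integrable (fun z => f (y + r * z)) (gaussianReal 0 1) := by
  have hC0 : 0 ≤ C := by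
    have := (abs_nonneg _).trans (hC 0)
    simpa using this
  refine Integrable.mono' (g := fun z => C * (1 + |y|) + C * |r| * |z|)
    ((integrable_const _).add (integrable_abs_gaussian.const_mul _))
    (by fun_prop) (ae_of_all _ fun z => ?_)
  rw [Real.norm_eq_abs]
  have h1 : |y + r * z| ≤ |y| + |r| * |z| := by
    rw [← abs_mul]; exact abs_add_le _ _
  calc _ ≤ C * (1 + |y + r * z|) := hC _
    _ ≤ C * (1 + (|y| + |r| * |z|)) := by gcongr
    _ = _ := by ring

theorem growth_of_bounded {f : ℝ → ℝ} {C : ℝ} (hC : ∀ x, |f x| ≤ C) (x : ℝ) :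
    |f x| ≤ C * (1 + |x|) := by
  have h0 : 0 ≤ C := (abs_nonneg _).trans (hC 0)
  nlinarith [hC x, mul_nonneg h0 (abs_nonneg x)]

theorem growth_of_deriv_bounded {f f' : ℝ → ℝ} {C : ℝ} (hd : ∀ x, HasDerivAt f (f' x) x)
    (hC : ∀ x, |f' x| ≤ C) (x : ℝ) : |f x| ≤ (|f 0| + C) * (1 + |x|) := by
  have h0 : 0 ≤ C := (abs_nonneg _).trans (hC 0)
  have := Convex.norm_image_sub_le_of_norm_hasDerivWithin_le (f := f) (f' := f') (C := C)
    (s := Set.univ) (x := 0) (y := x) (fun x _ => (hd x).hasDerivWithinAt) (fun x _ => hC x)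
    convex_univ trivial trivial
  simp only [Real.norm_eq_abs, sub_zero] at this
  have h2 : |f x| ≤ |f x - f 0| + |f 0| := by
    have := abs_add_le (f x - f 0) (f 0); simpa using this
  nlinarith [mul_nonneg (abs_nonneg (f 0)) (abs_nonneg x)]

theorem continuous_gaussAvg {f : ℝ → ℝ} (hf : Continuous f) {C : ℝ}
    (hC : ∀ x, |f x| ≤ C * (1 + |x|)) : Continuous (Function.uncurry (gaussAvg f)) := by
  have hC0 : 0 ≤ C := by
    have := (abs_nonneg _).trans (hC 0)
    simpa using this
  rw [continuous_iff_continuousAt]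
  rintro ⟨r₀, y₀⟩
  unfold Function.uncurry gaussAvg
  refine continuousAt_of_dominated
    (bound := fun z => C * (1 + (|y₀| + 1)) + C * (|r₀| + 1) * |z|)
    (Eventually.of_forall fun p => (by fun_prop)) ?_
    ((integrable_const _).add (integrable_abs_gaussian.const_mul _))
    (ae_of_all _ fun z => by fun_prop)
  have h1 : ∀ᶠ p : ℝ × ℝ in 𝓝 (r₀, y₀), |p.1| < |r₀| + 1 :=
    ContinuousAt.eventually_lt (f := fun p : ℝ × ℝ => |p.1|) (by fun_prop) (by fun_prop) (by simp)
  have h2 : ∀ᶠ p : ℝ × ℝ in 𝓝 (r₀, y₀), |p.2| < |y₀| + 1 :=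
    ContinuousAt.eventually_lt (f := fun p : ℝ × ℝ => |p.2|) (by fun_prop) (by fun_prop) (by simp)
  filter_upwards [h1, h2] with p hp1 hp2
  refine ae_of_all _ fun z => ?_
  rw [Real.norm_eq_abs]
  have h1 : |p.2 + p.1 * z| ≤ |p.2| + |p.1| * |z| := by
    rw [← abs_mul]; exact abs_add_le _ _
  calc _ ≤ C * (1 + |p.2 + p.1 * z|) := hC _
    _ ≤ C * (1 + ((|y₀| + 1) + (|r₀| + 1) * |z|)) := by
      gcongr
      refine h1.trans ?_
      gcongr
    _ = _ := by ring

theorem hasDerivAt_gaussAvg_right {f f' : ℝ → ℝ} {C : ℝ} (hd : ∀ x, HasDerivAt f (f' x) x)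
    (hf' : Continuous f') (hC : ∀ x, |f' x| ≤ C) (r y : ℝ) :
    HasDerivAt (gaussAvg f r) (gaussAvg f' r y) y := by
  have hf : Continuous f := continuous_iff_continuousAt.2 fun x => (hd x).continuousAt
  unfold gaussAvg
  refine (hasDerivAt_integral_of_dominated_loc_of_deriv_le (s := Set.univ) (bound := fun _ => C)
    (F := fun y z => f (y + r * z)) (F' := fun y z => f' (y + r * z)) univ_mem
    (Eventually.of_forall fun y => by fun_prop)
    (integrable_gauss_of_growth hf (growth_of_deriv_bounded hd hC) r y) (by fun_prop)
    (ae_of_all _ fun z y _ => hC _) (integrable_const _)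
    (ae_of_all _ fun z y _ => (hd _).comp_add_const y (r * z))).2

theorem hasDerivAt_gaussianPDFReal (x : ℝ) :
    HasDerivAt (gaussianPDFReal 0 1) (-x * gaussianPDFReal 0 1 x) x := by
  unfold gaussianPDFReal
  have h : HasDerivAt (fun x : ℝ => -(x - 0) ^ 2 / (2 * ((1 : NNReal) : ℝ))) (-x) x := by
    have := (((hasDerivAt_id x).sub_const 0).pow 2).neg.div_const (2 * ((1 : NNReal) : ℝ))
    refine this.congr_deriv ?_
    simp; ring
  refine (h.exp.const_mul _).congr_deriv ?_
  ring

/-- Gaussian integration by parts. -/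
theorem integral_mul_id_gaussian {h h' : ℝ → ℝ} {C C' : ℝ} (hd : ∀ x, HasDerivAt h (h' x) x)
    (hh' : Continuous h') (hC : ∀ x, |h x| ≤ C) (hC' : ∀ x, |h' x| ≤ C') :
    ∫ z, h z * z ∂(gaussianReal 0 1) = ∫ z, h' z ∂(gaussianReal 0 1) := by
  have hh : Continuous h := continuous_iff_continuousAt.2 fun x => (hd x).continuousAt
  rw [integral_gaussianReal_eq_integral_smul one_ne_zero,
    integral_gaussianReal_eq_integral_smul one_ne_zero]
  have hp := integrable_gaussianPDFReal 0 1
  have hxp : Integrable (fun x : ℝ => x * gaussianPDFReal 0 1 x) := by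
    have h1 := (memLp_id_gaussianReal (μ := 0) (v := 1) 1).integrable (by simp)
    rw [gaussianReal_of_var_ne_zero _ one_ne_zero,
      integrable_withDensity_iff (by fun_prop) (ae_of_all _ fun _ => gaussianPDF_lt_top)] at h1
    simpa using h1
  have hmul : ∀ {g k : ℝ → ℝ} {A : ℝ}, Continuous g → (∀ x, |g x| ≤ A) → Integrable k →
      Integrable (g * k) := fun hg hA hk => hk.bdd_mul hg.aestronglyMeasurable
        (ae_of_all _ hA)
  have := integral_mul_deriv_eq_deriv_mul_of_integrable (u := h) (u' := h')
    (v := gaussianPDFReal 0 1) (v' := fun x => -x * gaussianPDFReal 0 1 x)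
    (fun x _ => hd x) (fun x _ => hasDerivAt_gaussianPDFReal x)
    (hmul hh hC (by simpa using hxp.neg)) (hmul hh' hC' hp) (hmul hh hC hp)
  simp only [smul_eq_mul]
  rw [← neg_inj, ← integral_neg]
  calc _ = ∫ x, h x * (-x * gaussianPDFReal 0 1 x) := integral_congr_ae (ae_of_all _ fun x => by
        simp only []; ring)
    _ = _ := by rw [this]; simp only [mul_comm]

/-- By Gaussian integration by parts, `E[f'(y + r Z) Z] = r E[f''(y + r Z)]`. -/
theorem hasDerivAt_gaussAvg_left {f f' f'' : ℝ → ℝ} {C C' : ℝ} (hd : ∀ x, HasDerivAt f (f' x) x)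
    (hd' : ∀ x, HasDerivAt f' (f'' x) x) (hf'' : Continuous f'') (hC : ∀ x, |f' x| ≤ C)
    (hC' : ∀ x, |f'' x| ≤ C') (r y : ℝ) :
    HasDerivAt (fun r => gaussAvg f r y) (r * gaussAvg f'' r y) r := by
  have hf : Continuous f := continuous_iff_continuousAt.2 fun x => (hd x).continuousAt
  have hf' : Continuous f' := continuous_iff_continuousAt.2 fun x => (hd' x).continuousAt
  have key := (hasDerivAt_integral_of_dominated_loc_of_deriv_le (s := Set.univ) (x₀ := r)
    (μ := gaussianReal 0 1) (bound := fun z => C * |z|)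
    (F := fun r z => f (y + r * z)) (F' := fun r z => f' (y + r * z) * z) univ_mem
    (Eventually.of_forall fun y => by fun_prop)
    (integrable_gauss_of_growth hf (growth_of_deriv_bounded hd hC) r y) (by fun_prop)
    (ae_of_all _ fun z r _ => by
      rw [norm_mul, Real.norm_eq_abs, Real.norm_eq_abs]; gcongr; exact hC _)
    (integrable_abs_gaussian.const_mul _)
    (ae_of_all _ fun z r _ => by
      have h1 : HasDerivAt (fun r => y + r * z) z r := by
        simpa using ((hasDerivAt_id r).mul_const z).const_add y
      exact (hd _).comp r h1)).2
  unfold gaussAvg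
  refine key.congr_deriv ?_
  have h0 : ∀ x, HasDerivAt (fun z => f' (y + r * z)) (r * f'' (y + r * x)) x := fun x => by
    have h1 : HasDerivAt (fun z => y + r * z) r x := by
      simpa using ((hasDerivAt_id x).const_mul r).const_add y
    exact ((hd' _).comp x h1).congr_deriv (by ring)
  rw [integral_mul_id_gaussian h0 (by fun_prop) (C := C) (C' := |r| * C') (fun x => hC _)
    (fun x => by rw [abs_mul]; gcongr; exact hC' _), integral_const_mul]

/-- The solution `(t, y) ↦ E f(y + √(2t) Z)`, `Z` standard Gaussian, of the heat equation with
initial data `f`. It is extended to `t < 0` by `f`, since `√` vanishes there. -/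
noncomputable def heat (f : ℝ → ℝ) (t y : ℝ) : ℝ := gaussAvg f (√(2 * t)) y

theorem heat_zero (f : ℝ → ℝ) (y : ℝ) : heat f 0 y = f y := by
  simp [heat, gaussAvg]

theorem continuous_heat {f : ℝ → ℝ} (hf : Continuous f) {C : ℝ}
    (hC : ∀ x, |f x| ≤ C * (1 + |x|)) : Continuous (Function.uncurry (heat f)) :=
  (continuous_gaussAvg hf hC).comp
    (f := fun p : ℝ × ℝ => (√(2 * p.1), p.2)) (by fun_prop)

theorem hasDerivAt_heat_space {f f' : ℝ → ℝ} {C : ℝ} (hd : ∀ x, HasDerivAt f (f' x) x)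
    (hf' : Continuous f') (hC : ∀ x, |f' x| ≤ C) (t y : ℝ) :
    HasDerivAt (heat f t) (heat f' t y) y :=
  hasDerivAt_gaussAvg_right hd hf' hC _ y

theorem hasDerivAt_heat_time {f f' f'' : ℝ → ℝ} {C C' : ℝ} (hd : ∀ x, HasDerivAt f (f' x) x)
    (hd' : ∀ x, HasDerivAt f' (f'' x) x) (hf'' : Continuous f'') (hC : ∀ x, |f' x| ≤ C)
    (hC' : ∀ x, |f'' x| ≤ C') {t : ℝ} (ht : 0 < t) (y : ℝ) :
    HasDerivAt (fun t => heat f t y) (heat f'' t y) t := by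
  have h1 : HasDerivAt (fun t => √(2 * t)) (1 / √(2 * t)) t := by
    have := ((hasDerivAt_id t).const_mul 2).sqrt (by simpa using ht.ne')
    refine this.congr_deriv ?_
    simp only [id, mul_one]
    rw [div_mul_eq_div_div, div_self two_ne_zero]
  refine ((hasDerivAt_gaussAvg_left hd hd' hf'' hC hC' (√(2 * t)) y).comp t h1).congr_deriv ?_
  have : √(2 * t) ≠ 0 := (Real.sqrt_pos.2 (by positivity)).ne'
  unfold heat
  field_simp

theorem heat_mem_Icc {f : ℝ → ℝ} (hf : Continuous f) {a b : ℝ} (h : ∀ x, f x ∈ Set.Icc a b)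
    (t y : ℝ) : heat f t y ∈ Set.Icc a b := by
  have hi := integrable_gauss_of_growth hf (growth_of_bounded (C := max |a| |b|)
    fun x => abs_le_max_abs_abs (h x).1 (h x).2) (√(2 * t)) y
  unfold heat gaussAvg
  constructor
  · have := integral_mono (integrable_const a) hi fun z => (h (y + √(2 * t) * z)).1
    simpa using this
  · have := integral_mono hi (integrable_const b) fun z => (h (y + √(2 * t) * z)).2
    simpa using this

theorem heat_add_period {f : ℝ → ℝ} (hf : Continuous f) {C M c : ℝ}
    (hC : ∀ x, |f x| ≤ C * (1 + |x|)) (h : ∀ x, f (x + M) = f x + c) (t y : ℝ) :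
    heat f t (y + M) = heat f t y + c := by
  have hi := integrable_gauss_of_growth hf hC (√(2 * t)) y
  unfold heat gaussAvg
  calc _ = ∫ z, (f (y + √(2 * t) * z) + c) ∂(gaussianReal 0 1) := by
        refine integral_congr_ae (ae_of_all _ fun z => ?_)
        simp only []
        rw [← h]; congr 1; ring
    _ = _ := by rw [integral_add hi (integrable_const c)]; simp

/-! ### The hodograph transformation -/

theorem mul_abs_sub_le_of_le_deriv {f f' : ℝ → ℝ} {c : ℝ} (hd : ∀ x, HasDerivAt f (f' x) x)
    (hf' : ∀ x, c ≤ f' x) (x y : ℝ) : c * |x - y| ≤ |f x - f y| := by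
  have key : ∀ {a b : ℝ}, a ≤ b → c * (b - a) ≤ f b - f a := fun {a b} hab =>
    mul_sub_le_image_sub_of_le_deriv (fun x => (hd x).differentiableAt)
      (fun x => by rw [(hd x).deriv]; exact hf' x) hab
  rcases le_total x y with h | h
  · rw [abs_sub_comm x, abs_sub_comm (f x), abs_of_nonneg (sub_nonneg.2 h)]
    exact (key h).trans (le_abs_self _)
  · rw [abs_of_nonneg (sub_nonneg.2 h)]
    exact (key h).trans (le_abs_self _)

theorem exists_inverse_of_le_deriv {f f' : ℝ → ℝ} {c : ℝ} (hc : 0 < c)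
    (hd : ∀ x, HasDerivAt f (f' x) x) (hf' : ∀ x, c ≤ f' x) :
    ∃ g : ℝ → ℝ, (∀ y, f (g y) = y) ∧ (∀ x, g (f x) = x) := by
  have hcont : Continuous f := continuous_iff_continuousAt.2 fun x => (hd x).continuousAt
  have key : ∀ {a b : ℝ}, a ≤ b → c * (b - a) ≤ f b - f a := fun {a b} hab =>
    mul_sub_le_image_sub_of_le_deriv (fun x => (hd x).differentiableAt)
      (fun x => by rw [(hd x).deriv]; exact hf' x) hab
  have htop : Tendsto f atTop atTop := by
    refine tendsto_atTop_mono' (f₁ := fun x => c * x + f 0) _ ?_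
      (tendsto_atTop_add_const_right _ _ (tendsto_id.const_mul_atTop hc))
    filter_upwards [eventually_ge_atTop 0] with x hx
    have := key hx
    linarith
  have hbot : Tendsto f atBot atBot := by
    refine tendsto_atBot_mono' (f₁ := fun x => c * x + f 0) _ ?_
      (tendsto_atBot_add_const_right _ _ (tendsto_id.const_mul_atBot hc))
    filter_upwards [eventually_le_atBot 0] with x hx
    have := key hx
    linarith
  have hinj : Function.Injective f := fun x y hxy => by
    have := mul_abs_sub_le_of_le_deriv hd hf' x y
    rw [hxy, sub_self, abs_zero] at this
    have h2 : |x - y| ≤ 0 := by nlinarith [abs_nonneg (x - y)]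
    exact sub_eq_zero.1 (abs_nonpos_iff.1 h2)
  obtain ⟨g, hg⟩ := (hcont.surjective htop hbot).hasRightInverse
  exact ⟨g, hg, fun x => hinj (hg _)⟩

theorem hasDerivAt_inverse {f f' g : ℝ → ℝ} {c : ℝ} (hc : 0 < c)
    (hd : ∀ x, HasDerivAt f (f' x) x) (hf' : ∀ x, c ≤ f' x) (hg : ∀ y, f (g y) = y) (y : ℝ) :
    HasDerivAt g (f' (g y))⁻¹ y := by
  have hcont : ContinuousAt g y := by
    have : LipschitzWith (Real.toNNReal c⁻¹) g := LipschitzWith.of_dist_le_mul fun a b => by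
      have := mul_abs_sub_le_of_le_deriv hd hf' (g a) (g b)
      rw [hg, hg] at this
      rw [Real.dist_eq, Real.dist_eq, Real.coe_toNNReal _ (by positivity),
        inv_mul_eq_div, le_div_iff₀ hc]
      linarith
    exact this.continuous.continuousAt
  exact HasDerivAt.of_local_left_inverse hcont (hd _) (hc.trans_le (hf' _)).ne'
    (Eventually.of_forall hg)

/-- Chain rule along the curve `s ↦ (s, Y s)`. The time derivative of `F` is only required at
positive times. -/
theorem hasDerivAt_comp_of_partial {F Ft Fy : ℝ → ℝ → ℝ} {Y : ℝ → ℝ} {t Y' : ℝ}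
    (ht : 0 < t) (hFt : ∀ s, 0 < s → ∀ y, HasDerivAt (fun s => F s y) (Ft s y) s)
    (hFy : ∀ s y, HasDerivAt (F s) (Fy s y) y) (hcFt : Continuous (Function.uncurry Ft))
    (hcFy : Continuous (Function.uncurry Fy)) (hY : HasDerivAt Y Y' t) :
    HasDerivAt (fun s => F s (Y s)) (Ft t (Y t) + Fy t (Y t) * Y') t := by
  have key := hasStrictFDerivAt_uncurry_coprod (𝕜 := ℝ) (u := (t, Y t)) (f := F)
    (f₁ := fun s y => ContinuousLinearMap.toSpanSingleton ℝ (Ft s y))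
    (f₂ := fun s y => ContinuousLinearMap.toSpanSingleton ℝ (Fy s y))
    (by
      have : ∀ᶠ v : ℝ × ℝ in 𝓝 (t, Y t), 0 < v.1 :=
        ContinuousAt.eventually_lt (f := fun _ : ℝ × ℝ => (0 : ℝ)) (by fun_prop) (by fun_prop) ht
      filter_upwards [this] with v hv
      exact (hFt v.1 hv v.2).hasFDerivAt)
    (Eventually.of_forall fun v => (hFy v.1 v.2).hasFDerivAt)
    (by
      have := (ContinuousLinearMap.toSpanSingletonCLE (𝕜 := ℝ) (E := ℝ)).continuous.comp hcFt
      exact this.continuousAt)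
    (by
      have := (ContinuousLinearMap.toSpanSingletonCLE (𝕜 := ℝ) (E := ℝ)).continuous.comp hcFy
      exact this.continuousAt)
  have h2 : HasDerivAt (fun s => (s, Y s)) ((1 : ℝ), Y') t := (hasDerivAt_id t).prodMk hY
  have h3 := key.hasFDerivAt.comp_hasDerivAt (x := t) (f := fun s => (s, Y s)) h2
  refine h3.congr_deriv ?_
  simp [Function.HasUncurry.uncurry, mul_comm]

/-- The second factor need not be differentiable at a zero of the first one. -/
theorem hasDerivAt_mul_of_eq_zero {a b : ℝ → ℝ} {a' t : ℝ} (ha : HasDerivAt a a' t)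
    (h0 : a t = 0) (hb : ContinuousAt b t) : HasDerivAt (fun s => a s * b s) (a' * b t) t := by
  rw [hasDerivAt_iff_tendsto_slope] at ha ⊢
  refine (ha.mul (hb.tendsto.mono_left nhdsWithin_le_nhds)).congr fun s => ?_
  simp only [slope, vsub_eq_sub, smul_eq_mul, h0]
  ring

/-- Implicit differentiation in time of the family of inverse functions
`x ↦ Y t x` of `y ↦ X t y`. -/
theorem hasDerivAt_implicit {X X1 Xt : ℝ → ℝ → ℝ} {Y : ℝ → ℝ} {c t x : ℝ} (hc : 0 < c)
    (hXy : ∀ s y, HasDerivAt (X s) (X1 s y) y) (hX1 : ∀ s y, c ≤ X1 s y)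
    (hcX1 : Continuous (Function.uncurry X1))
    (hXt : HasDerivAt (fun s => X s (Y t)) (Xt t (Y t)) t) (hYc : Continuous Y)
    (hY : ∀ s, X s (Y s) = x) :
    HasDerivAt Y (-Xt t (Y t) / X1 t (Y t)) t := by
  set D : ℝ → ℝ := fun s => ∫ θ in (0 : ℝ)..1, X1 s (Y t + θ * (Y s - Y t)) with hD
  have hcont : ∀ s, Continuous fun θ : ℝ => X1 s (Y t + θ * (Y s - Y t)) := fun s =>
    hcX1.comp (f := fun θ : ℝ => (s, Y t + θ * (Y s - Y t))) (by fun_prop)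
  have hDc : Continuous D := by
    refine intervalIntegral.continuous_parametric_intervalIntegral_of_continuous' ?_ 0 1
    exact hcX1.comp (f := fun p : ℝ × ℝ => (p.1, Y t + p.2 * (Y p.1 - Y t))) (by fun_prop)
  have hDpos : ∀ s, c ≤ D s := fun s => by
    have := intervalIntegral.integral_mono_on (a := 0) (b := 1) zero_le_one
      (intervalIntegrable_const (μ := volume) (c := c)) ((hcont s).intervalIntegrable 0 1)
      (fun θ _ => hX1 s (Y t + θ * (Y s - Y t)))
    simpa using this
  -- the increment of `X s` is `D s` times the increment of the argument
  have hinc : ∀ s, D s * (Y s - Y t) = x - X s (Y t) := fun s => by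
    have h1 : ∀ θ ∈ Set.uIcc (0 : ℝ) 1, HasDerivAt (fun θ => X s (Y t + θ * (Y s - Y t)))
        (X1 s (Y t + θ * (Y s - Y t)) * (Y s - Y t)) θ := fun θ _ => by
      have h2 : HasDerivAt (fun θ : ℝ => Y t + θ * (Y s - Y t)) (Y s - Y t) θ := by
        simpa using ((hasDerivAt_id θ).mul_const (Y s - Y t)).const_add (Y t)
      exact (hXy s _).comp θ h2
    have := intervalIntegral.integral_eq_sub_of_hasDerivAt h1
      (((hcont s).mul continuous_const).intervalIntegrable 0 1)
    rw [intervalIntegral.integral_mul_const] at this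
    rw [hD]
    simp only [this, one_mul, zero_mul, add_zero, add_sub_cancel, hY]
  have hYeq : Y = fun s => (x - X s (Y t)) * (D s)⁻¹ + Y t := by
    funext s
    have := (hc.trans_le (hDpos s)).ne'
    rw [← hinc s]
    field_simp
    ring
  have hDt : D t = X1 t (Y t) := by simp [hD]
  have h := (hasDerivAt_mul_of_eq_zero (hXt.const_sub x) (by simp [hY])
    (hDc.continuousAt.inv₀ (hc.trans_le (hDpos t)).ne')).add_const (Y t)
  refine (h.congr_of_eventuallyEq (Eventually.of_forall fun s => congrFun hYeq s)).congr_deriv ?_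
  rw [Pi.inv_apply, hDt, div_eq_mul_inv]

/-- A positive classical solution `U` of `∂ₜ U = ∂ₓ (U⁻² ∂ₓ U)` on the line, with period one
in space, for which `W1 = U⁻² ∂ₓ U = ∂ₓ (-1/U)` and `W2 = ∂ₓ W1`. All functions are continuous up
to time `0` (they are also given values at negative times); the equation holds for `t > 0`. -/
structure IsClassicalSolution (m K : ℝ) (U W1 W2 : ℝ → ℝ → ℝ) : Prop where
  pos : 0 < m
  continuous_U : Continuous (Function.uncurry U)
  continuous_W1 : Continuous (Function.uncurry W1)
  continuous_W2 : Continuous (Function.uncurry W2)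
  periodic_U : ∀ t, Function.Periodic (U t) 1
  periodic_W1 : ∀ t, Function.Periodic (W1 t) 1
  periodic_W2 : ∀ t, Function.Periodic (W2 t) 1
  mem_Icc : ∀ t x, U t x ∈ Set.Icc m K
  deriv_U : ∀ t x, HasDerivAt (U t) ((U t x) ^ 2 * W1 t x) x
  deriv_W1 : ∀ t x, HasDerivAt (W1 t) (W2 t x) x
  equation : ∀ t, 0 < t → ∀ x, HasDerivAt (fun s => U s x) (W2 t x) t

theorem exists_bound_of_periodic {f : ℝ → ℝ} {c : ℝ} (hf : Function.Periodic f c) (hc : c ≠ 0)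
    (hcont : Continuous f) : ∃ C, ∀ x, |f x| ≤ C := by
  obtain ⟨C, hC⟩ := (hf.isBounded_of_continuous hc hcont).exists_norm_le
  exact ⟨C, fun x => hC _ ⟨x, rfl⟩⟩

theorem periodic_of_hasDerivAt {f f' : ℝ → ℝ} {c : ℝ} (hf : Function.Periodic f c)
    (hd : ∀ x, HasDerivAt f (f' x) x) : Function.Periodic f' c := fun x => by
  have h1 := (hd (x + c)).comp_add_const x c
  exact (h1.congr_of_eventuallyEq (Eventually.of_forall fun y => (hf y).symm)).unique (hd x)

/-- The hodograph transformation: for a solution `X` of the heat equation that is increasing in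
space, with inverse functions `Y t`, the function `∂ₓ Y` solves the nonlinear equation. -/
theorem isClassicalSolution_of_heat {X X1 X2 X3 Y : ℝ → ℝ → ℝ} {c k M : ℝ} (hc : 0 < c)
    (hcX : Continuous (Function.uncurry X)) (hcX1 : Continuous (Function.uncurry X1))
    (hcX2 : Continuous (Function.uncurry X2)) (hcX3 : Continuous (Function.uncurry X3))
    (hX1 : ∀ t y, HasDerivAt (X t) (X1 t y) y) (hX2 : ∀ t y, HasDerivAt (X1 t) (X2 t y) y)
    (hX3 : ∀ t y, HasDerivAt (X2 t) (X3 t y) y)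
    (hXt : ∀ t, 0 < t → ∀ y, HasDerivAt (fun s => X s y) (X2 t y) t)
    (hX1t : ∀ t, 0 < t → ∀ y, HasDerivAt (fun s => X1 s y) (X3 t y) t)
    (hb : ∀ t y, X1 t y ∈ Set.Icc c k)
    (hper : ∀ t y, X t (y + M) = X t y + 1)
    (hY : ∀ t x, X t (Y t x) = x) (hY' : ∀ t y, Y t (X t y) = y) :
    ∃ W1 W2, IsClassicalSolution k⁻¹ c⁻¹ (fun t x => (X1 t (Y t x))⁻¹) W1 W2 := by
  have hk : 0 < k := hc.trans_le ((hb 0 0).1.trans (hb 0 0).2)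
  have hne : ∀ t y, X1 t y ≠ 0 := fun t y => (hc.trans_le (hb t y).1).ne'
  have hYc : Continuous (Function.uncurry Y) := by
    rw [continuous_iff_continuousAt]
    rintro ⟨t₀, x₀⟩
    rw [ContinuousAt, tendsto_iff_dist_tendsto_zero]
    have hlim : Tendsto (fun p : ℝ × ℝ => c⁻¹ * |p.2 - X p.1 (Y t₀ x₀)|) (𝓝 (t₀, x₀)) (𝓝 0) := by
      have : Continuous fun p : ℝ × ℝ => c⁻¹ * |p.2 - X p.1 (Y t₀ x₀)| := by
        have := hcX.comp (f := fun p : ℝ × ℝ => (p.1, Y t₀ x₀)) (by fun_prop)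
        exact (continuous_const.mul (continuous_snd.sub this).abs)
      simpa [hY] using this.tendsto (t₀, x₀)
    refine squeeze_zero (fun _ => dist_nonneg) (fun p => ?_) hlim
    have := mul_abs_sub_le_of_le_deriv (hX1 p.1) (fun y => (hb p.1 y).1) (Y p.1 p.2) (Y t₀ x₀)
    rw [hY] at this
    rw [Real.dist_eq, inv_mul_eq_div, le_div_iff₀ hc, mul_comm]
    exact this
  have hYx : ∀ t x, HasDerivAt (Y t) (X1 t (Y t x))⁻¹ x := fun t x =>
    hasDerivAt_inverse hc (hX1 t) (fun y => (hb t y).1) (hY t) x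
  have hYt : ∀ t, 0 < t → ∀ x,
      HasDerivAt (fun s => Y s x) (-X2 t (Y t x) / X1 t (Y t x)) t := fun t ht x =>
    hasDerivAt_implicit (x := x) hc hX1 (fun s y => (hb s y).1) hcX1 (hXt t ht _)
      (hYc.comp (f := fun s => (s, x)) (by fun_prop)) (fun s => hY s x)
  have hYper : ∀ t x, Y t (x + 1) = Y t x + M := fun t x => by
    rw [← hY' t (Y t x + M), hper, hY]
  have hper1 : ∀ t, Function.Periodic (X1 t) M := fun t y =>
    ((((hX1 t (y + M)).comp_add_const y M).congr_of_eventuallyEq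
      (Eventually.of_forall fun y => (hper t y).symm)).unique ((hX1 t y).add_const 1))
  have hper2 : ∀ t, Function.Periodic (X2 t) M := fun t => periodic_of_hasDerivAt (hper1 t) (hX2 t)
  have hper3 : ∀ t, Function.Periodic (X3 t) M := fun t => periodic_of_hasDerivAt (hper2 t) (hX3 t)
  have hYc' : Continuous fun p : ℝ × ℝ => (p.1, Y p.1 p.2) := continuous_fst.prodMk hYc
  have hd1 : ∀ t x, HasDerivAt (fun x => X1 t (Y t x)) (X2 t (Y t x) * (X1 t (Y t x))⁻¹) x :=
    fun t x => (hX2 t _).comp x (hYx t x)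
  have hd2 : ∀ t x, HasDerivAt (fun x => X2 t (Y t x)) (X3 t (Y t x) * (X1 t (Y t x))⁻¹) x :=
    fun t x => (hX3 t _).comp x (hYx t x)
  have hcU := (hcX1.comp hYc').inv₀ (fun p => hne p.1 (Y p.1 p.2))
  refine ⟨fun t x => -X2 t (Y t x) * (X1 t (Y t x))⁻¹,
    fun t x => -(X3 t (Y t x) * ((X1 t (Y t x))⁻¹) ^ 2) +
      (X2 t (Y t x)) ^ 2 * ((X1 t (Y t x))⁻¹) ^ 3, ?_⟩
  refine ⟨inv_pos.2 hk, hcU, (hcX2.comp hYc').neg.mul hcU,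
    ((hcX3.comp hYc').mul (hcU.pow 2)).neg.add (((hcX2.comp hYc').pow 2).mul (hcU.pow 3)),
    fun t x => ?_, fun t x => ?_, fun t x => ?_, fun t x => ?_, fun t x => ?_, fun t x => ?_,
    fun t ht x => ?_⟩
  · simp only [hYper, hper1 t _]
  · simp only [hYper, hper1 t _, hper2 t _]
  · simp only [hYper, hper1 t _, hper2 t _, hper3 t _]
  · exact ⟨inv_anti₀ (hc.trans_le (hb _ _).1) (hb _ _).2, inv_anti₀ hc (hb _ _).1⟩
  · refine ((hd1 t x).inv (hne _ _)).congr_deriv ?_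
    have := hne t (Y t x)
    field_simp
  · refine ((hd2 t x).neg.mul ((hd1 t x).inv (hne _ _))).congr_deriv ?_
    have := hne t (Y t x)
    simp only [Pi.neg_apply, Pi.inv_apply]
    field_simp
  · refine ((hasDerivAt_comp_of_partial ht hX1t hX2 hcX3 hcX2 (hYt t ht x)).inv
      (hne _ _)).congr_deriv ?_
    have := hne t (Y t x)
    field_simp
    ring

/-- Global existence of a classical solution with `C²` initial data. -/
theorem exists_isClassicalSolution {u₀ : ℝ → ℝ} (hu : ContDiff ℝ 2 u₀)
    (hper : Function.Periodic u₀ 1) {ε : ℝ} (hε : 0 < ε) (hlow : ∀ x, ε ≤ u₀ x) :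
    ∃ m K U W1 W2, IsClassicalSolution m K U W1 W2 ∧ ∀ x, U 0 x = u₀ x := by
  have hu0 : Continuous u₀ := hu.continuous
  have hu' : ContDiff ℝ 1 (deriv u₀) := by
    have : ContDiff ℝ (1 + 1) u₀ := by norm_num; exact hu
    exact (contDiff_succ_iff_deriv.1 this).2.2
  have hd0 : ∀ x, HasDerivAt u₀ (deriv u₀ x) x := fun x =>
    (hu.differentiable (by norm_num) x).hasDerivAt
  have hd1 : ∀ x, HasDerivAt (deriv u₀) (deriv (deriv u₀) x) x := fun x =>
    (hu'.differentiable (by norm_num) x).hasDerivAt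
  have hc1 : Continuous (deriv u₀) := hu'.continuous
  have hc2 : Continuous (deriv (deriv u₀)) := hu'.continuous_deriv le_rfl
  have hp1 := periodic_of_hasDerivAt hper hd0
  have hp2 := periodic_of_hasDerivAt hp1 hd1
  obtain ⟨K, hK⟩ := exists_bound_of_periodic hper one_ne_zero hu0
  -- the mass coordinate and its inverse
  set Y₀ : ℝ → ℝ := fun x => ∫ s in (0 : ℝ)..x, u₀ s with hY₀
  have hdY : ∀ x, HasDerivAt Y₀ (u₀ x) x := fun x =>
    intervalIntegral.integral_hasDerivAt_right (hu0.intervalIntegrable _ _)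
      hu0.aestronglyMeasurable.stronglyMeasurableAtFilter hu0.continuousAt
  obtain ⟨X₀, hYX, hXY⟩ := exists_inverse_of_le_deriv hε hdY hlow
  set M : ℝ := ∫ s in (0 : ℝ)..1, u₀ s with hM
  have hMpos : 0 < M := by
    have := intervalIntegral.integral_mono_on (a := 0) (b := 1) zero_le_one
      (intervalIntegrable_const (μ := volume) (c := ε)) (hu0.intervalIntegrable 0 1)
      (fun x _ => hlow x)
    have h2 : ε ≤ M := by simpa using this
    exact hε.trans_le h2
  have hYper : ∀ x, Y₀ (x + 1) = Y₀ x + M := fun x => by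
    have := hper.intervalIntegral_add_eq_add 0 x (fun a b => hu0.intervalIntegrable a b)
    simpa [hY₀, hM] using this
  have hXper : ∀ y, X₀ (y + M) = X₀ y + 1 := fun y => by
    rw [← hXY (X₀ y + 1), hYper, hYX]
  set A1 : ℝ → ℝ := fun y => (u₀ (X₀ y))⁻¹ with hA1
  set A2 : ℝ → ℝ := fun y => -deriv u₀ (X₀ y) * (A1 y) ^ 3 with hA2
  set A3 : ℝ → ℝ := fun y => -deriv (deriv u₀) (X₀ y) * (A1 y) ^ 4 -
    deriv u₀ (X₀ y) * (3 * (A1 y) ^ 2 * A2 y) with hA3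
  have hne : ∀ x, u₀ x ≠ 0 := fun x => (hε.trans_le (hlow x)).ne'
  have hdX : ∀ y, HasDerivAt X₀ (A1 y) y := hasDerivAt_inverse hε hdY hlow hYX
  have hX0c : Continuous X₀ := continuous_iff_continuousAt.2 fun x => (hdX x).continuousAt
  have hdA1 : ∀ y, HasDerivAt A1 (A2 y) y := fun y => by
    refine (((hd0 _).comp y (hdX y)).inv (hne _)).congr_deriv ?_
    have := hne (X₀ y)
    simp only [hA2, hA1, Function.comp]
    field_simp
  have hA1c : Continuous A1 := continuous_iff_continuousAt.2 fun x => (hdA1 x).continuousAt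
  have hdA2 : ∀ y, HasDerivAt A2 (A3 y) y := fun y => by
    refine (((hd1 _).comp y (hdX y)).neg.mul ((hdA1 y).pow 3)).congr_deriv ?_
    simp only [hA3, Function.comp, Pi.neg_apply, Pi.pow_apply]
    push_cast
    ring
  have hA2c : Continuous A2 := continuous_iff_continuousAt.2 fun x => (hdA2 x).continuousAt
  have hA3c : Continuous A3 :=
    ((hc2.comp hX0c).neg.mul (hA1c.pow 4)).sub
      ((hc1.comp hX0c).mul ((continuous_const.mul (hA1c.pow 2)).mul hA2c))
  have hA1p : Function.Periodic A1 M := fun y => by simp only [hA1, hXper, hper _]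
  have hA2p := periodic_of_hasDerivAt hA1p hdA1
  have hA3p := periodic_of_hasDerivAt hA2p hdA2
  obtain ⟨C1, hC1⟩ := exists_bound_of_periodic hA1p hMpos.ne' hA1c
  obtain ⟨C2, hC2⟩ := exists_bound_of_periodic hA2p hMpos.ne' hA2c
  obtain ⟨C3, hC3⟩ := exists_bound_of_periodic hA3p hMpos.ne' hA3c
  have hKpos : 0 < K := hε.trans_le ((hlow 0).trans ((le_abs_self _).trans (hK 0)))
  have hA1b : ∀ y, A1 y ∈ Set.Icc K⁻¹ ε⁻¹ := fun y =>
    ⟨inv_anti₀ (hε.trans_le (hlow _)) ((le_abs_self _).trans (hK _)), inv_anti₀ hε (hlow _)⟩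
  have hXg := growth_of_deriv_bounded hdX hC1
  have hb : ∀ t y, heat A1 t y ∈ Set.Icc K⁻¹ ε⁻¹ := heat_mem_Icc hA1c hA1b
  have hdX1 := hasDerivAt_heat_space hdX hA1c hC1
  choose Y hY hY' using fun t => exists_inverse_of_le_deriv (inv_pos.2 hKpos) (hdX1 t)
    (fun y => (hb t y).1)
  obtain ⟨W1, W2, h⟩ := isClassicalSolution_of_heat (M := M) (inv_pos.2 hKpos)
    (continuous_heat hX0c hXg) (continuous_heat hA1c (growth_of_bounded hC1))
    (continuous_heat hA2c (growth_of_bounded hC2)) (continuous_heat hA3c (growth_of_bounded hC3))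
    hdX1 (hasDerivAt_heat_space hdA1 hA2c hC2) (hasDerivAt_heat_space hdA2 hA3c hC3)
    (fun t ht y => hasDerivAt_heat_time hdX hdA1 hA2c hC1 hC2 ht y)
    (fun t ht y => hasDerivAt_heat_time hdA1 hdA2 hA3c hC2 hC3 ht y)
    hb (heat_add_period hX0c hXg hXper) hY hY'
  refine ⟨_, _, _, W1, W2, h, fun x => ?_⟩
  have hY0 : Y 0 x = Y₀ x := by
    have := hY' 0 (Y₀ x)
    rwa [heat_zero, hXY] at this
  simp only [heat_zero, hY0, hA1, hXY, inv_inv]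

/-! ### Functions on space-time and the energy space -/

theorem continuous_uncurry_of_lift {v : ℝ → UnitAddCircle → ℝ}
    (h : Continuous fun q : ℝ × ℝ => v q.1 (q.2 : UnitAddCircle)) :
    Continuous (Function.uncurry v) := by
  have hq : IsOpenQuotientMap (fun y : ℝ => (y : UnitAddCircle)) :=
    QuotientAddGroup.isOpenQuotientMap_mk
  exact ((IsOpenQuotientMap.id (X := ℝ)).prodMap hq).isQuotientMap.continuous_iff.2 h

theorem continuous_lift {v : ℝ → UnitAddCircle → ℝ} (h : Continuous (Function.uncurry v)) :
    Continuous fun q : ℝ × ℝ => v q.1 (q.2 : UnitAddCircle) :=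
  h.comp (f := fun q : ℝ × ℝ => (q.1, (q.2 : UnitAddCircle)))
    (continuous_fst.prodMk ((AddCircle.continuous_mk' 1).comp continuous_snd))

/-- `p` is the space derivative of `f` in the classical sense. -/
def HasSpaceDeriv (f p : ℝ → UnitAddCircle → ℝ) : Prop :=
  ∀ t (y : ℝ), HasDerivAt (fun y : ℝ => f t (y : UnitAddCircle)) (p t (y : UnitAddCircle)) y

theorem HasSpaceDeriv.dx_eq {f p : ℝ → UnitAddCircle → ℝ} (h : HasSpaceDeriv f p) : dx f = p := by
  funext t x
  induction x using QuotientAddGroup.induction_on with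
  | H y =>
    have h1 : HasDerivAt (fun y : ℝ => f t (y : UnitAddCircle)) (p t (y : UnitAddCircle))
        (y + 0) := by rw [add_zero]; exact h t y
    have := (h1.comp_const_add y 0).deriv
    rw [← this]
    rfl

theorem IsC1.hasSpaceDeriv {g : ℝ → UnitAddCircle → ℝ} (hg : IsC1 g) :
    HasSpaceDeriv g (dx g) := by
  have key : ∀ t (y : ℝ), HasDerivAt (fun y : ℝ => g t (y : UnitAddCircle))
      (fderiv ℝ (fun q : ℝ × ℝ => g q.1 (q.2 : UnitAddCircle)) (t, y) (0, 1)) y := fun t y =>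
    (hg.differentiable (by norm_num) (t, y)).hasFDerivAt.comp_hasDerivAt y
      ((hasDerivAt_const y t).prodMk (hasDerivAt_id y))
  intro t y
  refine (key t y).congr_deriv ?_
  have h1 := key t (y + 0)
  have := (h1.comp_const_add y 0).deriv
  rw [add_zero] at this
  rw [← this]
  rfl

theorem IsC1.hasDerivAt_dt {g : ℝ → UnitAddCircle → ℝ} (hg : IsC1 g) (t : ℝ) (x : UnitAddCircle) :
    HasDerivAt (fun s => g s x) (dt g t x) t := by
  induction x using QuotientAddGroup.induction_on with
  | H y =>
    have : HasDerivAt (fun s : ℝ => g s (y : UnitAddCircle))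
        (fderiv ℝ (fun q : ℝ × ℝ => g q.1 (q.2 : UnitAddCircle)) (t, y) (1, 0)) t :=
      (hg.differentiable (by norm_num) (t, y)).hasFDerivAt.comp_hasDerivAt t
        (f := fun s : ℝ => (s, y)) ((hasDerivAt_id t).prodMk (hasDerivAt_const t y))
    exact this.differentiableAt.hasDerivAt

theorem IsC1.continuous {g : ℝ → UnitAddCircle → ℝ} (hg : IsC1 g) :
    Continuous (Function.uncurry g) :=
  continuous_uncurry_of_lift (ContDiff.continuous hg)

theorem IsC1.continuous_dx {g : ℝ → UnitAddCircle → ℝ} (hg : IsC1 g) :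
    Continuous (Function.uncurry (dx g)) := by
  refine continuous_uncurry_of_lift ?_
  have h1 : Continuous fun q : ℝ × ℝ =>
      fderiv ℝ (fun q : ℝ × ℝ => g q.1 (q.2 : UnitAddCircle)) q (0, 1) :=
    (ContDiff.continuous_fderiv hg (by norm_num)).clm_apply continuous_const
  refine h1.congr fun q => ?_
  have : HasDerivAt (fun y : ℝ => g q.1 (y : UnitAddCircle))
      (fderiv ℝ (fun q : ℝ × ℝ => g q.1 (q.2 : UnitAddCircle)) q (0, 1)) q.2 :=
    (hg.differentiable (by norm_num) q).hasFDerivAt.comp_hasDerivAt q.2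
      (f := fun y : ℝ => (q.1, y)) ((hasDerivAt_const q.2 q.1).prodMk (hasDerivAt_id q.2))
  exact this.unique (hg.hasSpaceDeriv q.1 q.2)

theorem IsC1.continuous_dt {g : ℝ → UnitAddCircle → ℝ} (hg : IsC1 g) :
    Continuous (Function.uncurry (dt g)) := by
  refine continuous_uncurry_of_lift ?_
  have h1 : Continuous fun q : ℝ × ℝ =>
      fderiv ℝ (fun q : ℝ × ℝ => g q.1 (q.2 : UnitAddCircle)) q (1, 0) :=
    (ContDiff.continuous_fderiv hg (by norm_num)).clm_apply continuous_const
  refine h1.congr fun q => ?_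
  have : HasDerivAt (fun s : ℝ => g s (q.2 : UnitAddCircle))
      (fderiv ℝ (fun q : ℝ × ℝ => g q.1 (q.2 : UnitAddCircle)) q (1, 0)) q.1 :=
    (hg.differentiable (by norm_num) q).hasFDerivAt.comp_hasDerivAt q.1
      (f := fun s : ℝ => (s, q.2)) ((hasDerivAt_id q.1).prodMk (hasDerivAt_const q.1 q.2))
  exact this.unique (hg.hasDerivAt_dt q.1 q.2)

theorem isC1_of_partial {g gt gx : ℝ → UnitAddCircle → ℝ}
    (ht : ∀ t x, HasDerivAt (fun s => g s x) (gt t x) t) (hx : HasSpaceDeriv g gx)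
    (hgt : Continuous (Function.uncurry gt)) (hgx : Continuous (Function.uncurry gx)) :
    IsC1 g := by
  have hct := (ContinuousLinearMap.toSpanSingletonCLE (𝕜 := ℝ) (E := ℝ)).continuous.comp
    (continuous_lift hgt)
  have hcx := (ContinuousLinearMap.toSpanSingletonCLE (𝕜 := ℝ) (E := ℝ)).continuous.comp
    (continuous_lift hgx)
  have key : ∀ q : ℝ × ℝ, HasFDerivAt (fun q : ℝ × ℝ => g q.1 (q.2 : UnitAddCircle))
      ((ContinuousLinearMap.toSpanSingleton ℝ (gt q.1 (q.2 : UnitAddCircle))).coprod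
        (ContinuousLinearMap.toSpanSingleton ℝ (gx q.1 (q.2 : UnitAddCircle)))) q := fun q =>
    (hasStrictFDerivAt_uncurry_coprod (𝕜 := ℝ) (u := q)
      (f := fun (t y : ℝ) => g t (y : UnitAddCircle))
      (f₁ := fun (t y : ℝ) => ContinuousLinearMap.toSpanSingleton ℝ (gt t (y : UnitAddCircle)))
      (f₂ := fun (t y : ℝ) => ContinuousLinearMap.toSpanSingleton ℝ (gx t (y : UnitAddCircle)))
      (Eventually.of_forall fun v => (ht v.1 v.2).hasFDerivAt)
      (Eventually.of_forall fun v => (hx v.1 v.2).hasFDerivAt)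
      hct.continuousAt hcx.continuousAt).hasFDerivAt
  unfold IsC1
  rw [contDiff_one_iff_fderiv]
  refine ⟨fun q => (key q).differentiableAt, ?_⟩
  have : fderiv ℝ (fun q : ℝ × ℝ => g q.1 (q.2 : UnitAddCircle)) = fun q =>
      ((ContinuousLinearMap.toSpanSingleton ℝ (gt q.1 (q.2 : UnitAddCircle))).coprod
        (ContinuousLinearMap.toSpanSingleton ℝ (gx q.1 (q.2 : UnitAddCircle)))) :=
    funext fun q => (key q).fderiv
  rw [this]
  have h2 := (ContinuousLinearMap.coprodEquivL ℝ (E := ℝ) (F := ℝ) (G := ℝ)).continuous.comp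
    (hct.prodMk hcx)
  exact h2

theorem hasSpaceDeriv_integral {f p : ℝ → UnitAddCircle → ℝ} (hf : Continuous (Function.uncurry f))
    (hp : Continuous (Function.uncurry p)) (hd : HasSpaceDeriv f p) (a b : ℝ → ℝ) :
    HasSpaceDeriv (fun t x => ∫ s in a t..b t, f s x) (fun t x => ∫ s in a t..b t, p s x) := by
  intro t y
  have hlf := continuous_lift hf
  have hlp := continuous_lift hp
  obtain ⟨C, hC⟩ := (isCompact_uIcc.prod
    (isCompact_Icc (a := y - 1) (b := y + 1))).exists_bound_of_continuousOn
    (hlp.continuousOn (s := Set.uIcc (a t) (b t) ×ˢ Set.Icc (y - 1) (y + 1)))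
  refine (intervalIntegral.hasDerivAt_integral_of_dominated_loc_of_deriv_le (μ := volume)
    (s := Set.Icc (y - 1) (y + 1)) (bound := fun _ => C)
    (F := fun (y s : ℝ) => f s (y : UnitAddCircle)) (F' := fun (y s : ℝ) => p s (y : UnitAddCircle))
    (Icc_mem_nhds (by linarith) (by linarith))
    (Eventually.of_forall fun y => ?_) ?_ ?_ ?_ intervalIntegrable_const ?_).2
  · exact (hlf.comp (f := fun s : ℝ => (s, y)) (by fun_prop)).aestronglyMeasurable
  · exact (hlf.comp (f := fun s : ℝ => (s, y)) (by fun_prop)).intervalIntegrable _ _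
  · exact (hlp.comp (f := fun s : ℝ => (s, y)) (by fun_prop)).aestronglyMeasurable
  · exact ae_of_all _ fun s hs x hx => hC (s, x) ⟨Set.uIoc_subset_uIcc hs, hx⟩
  · exact ae_of_all _ fun s _ x _ => hd s x

theorem continuous_slice {f : ℝ → UnitAddCircle → ℝ} (hf : Continuous (Function.uncurry f))
    (x : UnitAddCircle) : Continuous fun s => f s x :=
  hf.comp (f := fun s : ℝ => (s, x)) (by fun_prop)

theorem continuous_integral_slices {f : ℝ → UnitAddCircle → ℝ}
    (hf : Continuous (Function.uncurry f)) {a b : ℝ → ℝ} (ha : Continuous a) (hb : Continuous b) :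
    Continuous (Function.uncurry fun t x => ∫ s in a t..b t, f s x) := by
  have hg : Continuous (Function.uncurry fun (q : ℝ × UnitAddCircle) (s : ℝ) => f s q.2) :=
    hf.comp (f := fun r : (ℝ × UnitAddCircle) × ℝ => (r.2, r.1.2)) (by fun_prop)
  have h1 := intervalIntegral.continuous_parametric_intervalIntegral_of_continuous (μ := volume)
    (a₀ := 0) hg (s := fun q => b q.1) (by fun_prop)
  have h2 := intervalIntegral.continuous_parametric_intervalIntegral_of_continuous (μ := volume)
    (a₀ := 0) hg (s := fun q => a q.1) (by fun_prop)
  refine (h1.sub h2).congr fun q => ?_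
  have hs := continuous_slice hf q.2
  exact intervalIntegral.integral_interval_sub_left (hs.intervalIntegrable _ _)
    (hs.intervalIntegrable _ _)

theorem hasDerivAt_primitive {f : ℝ → UnitAddCircle → ℝ} (hf : Continuous (Function.uncurry f))
    (a t : ℝ) (x : UnitAddCircle) : HasDerivAt (fun t => ∫ s in a..t, f s x) (f t x) t := by
  have hs := continuous_slice hf x
  exact intervalIntegral.integral_hasDerivAt_right (hs.intervalIntegrable _ _)
    hs.aestronglyMeasurable.stronglyMeasurableAtFilter hs.continuousAt

theorem ae_spaceTime {S : ℝ} {P : ℝ × UnitAddCircle → Prop}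
    (h : ∀ t ∈ Set.Icc 0 S, ∀ x, P (t, x)) : ∀ᵐ z ∂(spaceTime S), P z := by
  have : spaceTime S = (volume.prod volume).restrict (Set.Icc 0 S ×ˢ Set.univ) := by
    rw [← Measure.prod_restrict, Measure.restrict_univ]; rfl
  rw [this]
  filter_upwards [ae_restrict_mem (measurableSet_Icc.prod MeasurableSet.univ)] with z hz
  exact h z.1 hz.1 z.2

instance (S : ℝ) : IsFiniteMeasure (spaceTime S) := by
  unfold spaceTime; infer_instance

theorem memLp_of_continuous {f : ℝ × UnitAddCircle → ℝ} (hf : Continuous f) (S : ℝ) (p : ENNReal) :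
    MemLp f p (spaceTime S) := by
  obtain ⟨C, hC⟩ := ((isCompact_Icc (a := (0 : ℝ)) (b := S)).prod
    (isCompact_univ (X := UnitAddCircle))).exists_bound_of_continuousOn hf.continuousOn
  exact MemLp.of_bound hf.aestronglyMeasurable C
    (ae_spaceTime fun t ht x => hC (t, x) ⟨ht, trivial⟩)

theorem integrable_of_continuous {f : ℝ × UnitAddCircle → ℝ} (hf : Continuous f) (S : ℝ) :
    Integrable f (spaceTime S) :=
  memLp_one_iff_integrable.1 (memLp_of_continuous hf S 1)

theorem integral_spaceTime {S : ℝ} {f : ℝ × UnitAddCircle → ℝ} (hf : Continuous f) :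
    ∫ z, f z ∂(spaceTime S) = ∫ t in Set.Icc 0 S, ∫ x, f (t, x) :=
  integral_prod f (integrable_of_continuous hf S)

theorem integral_spaceTime_symm {S : ℝ} (hS : 0 ≤ S) {f : ℝ × UnitAddCircle → ℝ}
    (hf : Continuous f) :
    ∫ z, f z ∂(spaceTime S) = ∫ x, ∫ t in (0 : ℝ)..S, f (t, x) := by
  unfold spaceTime
  rw [integral_prod_symm f (integrable_of_continuous hf S)]
  simp only [intervalIntegral.integral_of_le hS, integral_Icc_eq_integral_Ioc]

theorem tendsto_eLpNorm_of_tendstoUniformly {S : ℝ} {F : ℕ → ℝ → UnitAddCircle → ℝ}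
    {f : ℝ → UnitAddCircle → ℝ}
    (h : ∀ η > 0, ∀ᶠ k in atTop, ∀ t ∈ Set.Icc 0 S, ∀ x, |F k t x - f t x| ≤ η) :
    Tendsto (fun k => eLpNorm (fun z => F k z.1 z.2 - f z.1 z.2) 2 (spaceTime S))
      atTop (𝓝 0) := by
  set A : ENNReal := (spaceTime S Set.univ) ^ ((2 : ENNReal).toReal)⁻¹ with hA
  have hAtop : A ≠ ⊤ := ENNReal.rpow_ne_top_of_nonneg (by positivity) (measure_ne_top _ _)
  rw [ENNReal.tendsto_nhds_zero]
  intro δ hδ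
  have hlim : Tendsto (fun η : ℝ => A * ENNReal.ofReal η) (𝓝[>] 0) (𝓝 0) := by
    have : Tendsto (fun η : ℝ => A * ENNReal.ofReal η) (𝓝 0) (𝓝 (A * ENNReal.ofReal 0)) :=
      ENNReal.Tendsto.const_mul (ENNReal.tendsto_ofReal tendsto_id) (Or.inr hAtop)
    simpa using this.mono_left nhdsWithin_le_nhds
  obtain ⟨η, hη, hη0⟩ := ((ENNReal.tendsto_nhds_zero.1 hlim δ hδ).and self_mem_nhdsWithin).exists
  filter_upwards [h η hη0] with k hk
  exact (eLpNorm_le_of_ae_bound (ae_spaceTime fun t ht x => hk t ht x)).trans hη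

/-- Average of `f` over the time interval between `t` and `t + h`. -/
noncomputable def timeAverage (f : ℝ → UnitAddCircle → ℝ) (h t : ℝ) (x : UnitAddCircle) : ℝ :=
  ∫ θ in (0 : ℝ)..1, f (t + h * θ) x

theorem timeAverage_eq (f : ℝ → UnitAddCircle → ℝ) {h : ℝ} (hh : h ≠ 0) (t : ℝ)
    (x : UnitAddCircle) : timeAverage f h t x = h⁻¹ * ∫ s in t..t + h, f s x := by
  unfold timeAverage
  rw [intervalIntegral.integral_comp_add_mul (fun s => f s x) hh t]
  simp

/-- Time averages converge uniformly on `[0, S] × 𝕋`, by compactness. -/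
theorem eventually_abs_timeAverage_sub_le {f : ℝ → UnitAddCircle → ℝ}
    (hf : Continuous (Function.uncurry f)) (S : ℝ) {η : ℝ} (hη : 0 < η) :
    ∀ᶠ h in 𝓝 0, ∀ t ∈ Set.Icc 0 S, ∀ x, |timeAverage f h t x - f t x| ≤ η := by
  have hc : Continuous (fun q : ℝ × (Set.Icc (0 : ℝ) S × UnitAddCircle) =>
      timeAverage f q.1 q.2.1 q.2.2) := by
    unfold timeAverage
    refine intervalIntegral.continuous_parametric_intervalIntegral_of_continuous' ?_ 0 1
    exact hf.comp (f := fun r : (ℝ × (Set.Icc (0 : ℝ) S × UnitAddCircle)) × ℝ =>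
      ((r.1.2.1 : ℝ) + r.1.1 * r.2, r.1.2.2)) (by fun_prop)
  have := Continuous.tendstoUniformly
    (fun (h : ℝ) (q : Set.Icc (0 : ℝ) S × UnitAddCircle) => timeAverage f h q.1 q.2) hc 0
  rw [Metric.tendstoUniformly_iff] at this
  filter_upwards [this η hη] with h hh t ht x
  have := hh (⟨t, ht⟩, x)
  rw [dist_comm, Real.dist_eq] at this
  simpa [timeAverage] using this.le

theorem tendsto_one_div_succ : Tendsto (fun k : ℕ => ((k : ℝ) + 1)⁻¹) atTop (𝓝 0) := by
  simpa using tendsto_one_div_add_atTop_nhds_zero_nat (𝕜 := ℝ)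

/-- A continuous function with continuous space derivative belongs to the energy space: its
averages over small time intervals are continuously differentiable. -/
theorem hasEnergyDeriv_of_continuous {f p : ℝ → UnitAddCircle → ℝ}
    (hf : Continuous (Function.uncurry f)) (hp : Continuous (Function.uncurry p))
    (hd : HasSpaceDeriv f p) (S : ℝ) : HasEnergyDeriv S f p := by
  have hne : ∀ k : ℕ, ((k : ℝ) + 1)⁻¹ ≠ 0 := fun k => by positivity
  have hsd : ∀ k : ℕ, HasSpaceDeriv (timeAverage f ((k : ℝ) + 1)⁻¹)
      (timeAverage p ((k : ℝ) + 1)⁻¹) := fun k t y => by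
    simp only [timeAverage_eq _ (hne k)]
    exact (hasSpaceDeriv_integral hf hp hd (fun t => t)
      (fun t => t + ((k : ℝ) + 1)⁻¹) t y).const_mul _
  have hcont : ∀ {q : ℝ → UnitAddCircle → ℝ}, Continuous (Function.uncurry q) → ∀ k : ℕ,
      Continuous (Function.uncurry (timeAverage q ((k : ℝ) + 1)⁻¹)) := fun {q} hq k => by
    refine ((continuous_const (y := (((k : ℝ) + 1)⁻¹)⁻¹)).mul
      (continuous_integral_slices hq (a := fun t => t) (b := fun t => t + ((k : ℝ) + 1)⁻¹)
        (by fun_prop) (by fun_prop))).congr fun z => ?_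
    exact (timeAverage_eq _ (hne k) z.1 z.2).symm
  refine ⟨memLp_of_continuous hf S 2, memLp_of_continuous hp S 2,
    fun k => timeAverage f ((k : ℝ) + 1)⁻¹, fun k => ?_, ?_, ?_⟩
  · refine isC1_of_partial (gt := fun t x => ((k : ℝ) + 1) *
      (f (t + ((k : ℝ) + 1)⁻¹) x - f t x)) (fun t x => ?_) (hsd k) ?_ (hcont hp k)
    · have h1 := hasDerivAt_primitive hf 0 t x
      have h2 := (hasDerivAt_primitive hf 0 (t + ((k : ℝ) + 1)⁻¹) x).comp_add_const t
        ((k : ℝ) + 1)⁻¹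
      refine (((h2.sub h1).const_mul ((k : ℝ) + 1)).congr_of_eventuallyEq
        (Eventually.of_forall fun s => ?_))
      have hs := continuous_slice hf x
      simp only [timeAverage_eq _ (hne k), inv_inv, Pi.sub_apply]
      rw [intervalIntegral.integral_interval_sub_left (hs.intervalIntegrable _ _)
        (hs.intervalIntegrable _ _)]
    · exact continuous_const.mul ((hf.comp (f := fun z : ℝ × UnitAddCircle =>
        (z.1 + ((k : ℝ) + 1)⁻¹, z.2)) (by fun_prop)).sub hf)
  · exact tendsto_eLpNorm_of_tendstoUniformly fun η hη =>
      tendsto_one_div_succ.eventually (eventually_abs_timeAverage_sub_le hf S hη)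
  · simp only [(hsd _).dx_eq]
    exact tendsto_eLpNorm_of_tendstoUniformly fun η hη =>
      tendsto_one_div_succ.eventually (eventually_abs_timeAverage_sub_le hp S hη)

theorem integral_spaceDeriv_eq_zero {f p : ℝ → UnitAddCircle → ℝ}
    (hp : Continuous (Function.uncurry p)) (hd : HasSpaceDeriv f p) (t : ℝ) :
    ∫ x, p t x = 0 := by
  rw [← UnitAddCircle.intervalIntegral_preimage 0, intervalIntegral.integral_eq_sub_of_hasDerivAt
    (fun y _ => hd t y) (((continuous_lift hp).comp (f := fun y : ℝ => (t, y))
      (by fun_prop)).intervalIntegrable _ _)]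
  have : ((0 + 1 : ℝ) : UnitAddCircle) = ((0 : ℝ) : UnitAddCircle) := by
    rw [AddCircle.coe_add, AddCircle.coe_period, add_zero]
  rw [this, sub_self]

theorem HasSpaceDeriv.neg_inv {u w1 : ℝ → UnitAddCircle → ℝ} (hpos : ∀ t x, 0 < u t x)
    (hdu : HasSpaceDeriv u (fun t x => u t x ^ 2 * w1 t x)) :
    HasSpaceDeriv (fun t x => -(u t x)⁻¹) w1 := fun t y => by
  refine ((hdu t y).inv (hpos _ _).ne').neg.congr_deriv ?_
  have := (hpos t y).ne'
  field_simp

/-- A solution that is classical for `t > 0`, with space derivatives continuous up to `t = 0`, is a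
weak solution: integrate by parts in time for fixed `x` and in space for fixed `t`. -/
theorem isEnergySolution_of_classical {S : ℝ} (hS : 0 < S) {u₀ : UnitAddCircle → ℝ}
    {u w1 w2 : ℝ → UnitAddCircle → ℝ}
    (hu : Continuous (Function.uncurry u)) (hw1 : Continuous (Function.uncurry w1))
    (hw2 : Continuous (Function.uncurry w2)) (hpos : ∀ t x, 0 < u t x) (h0 : ∀ x, u 0 x = u₀ x)
    (hdu : HasSpaceDeriv u (fun t x => u t x ^ 2 * w1 t x)) (hdw : HasSpaceDeriv w1 w2)
    (heq : ∀ t, 0 < t → ∀ x, HasDerivAt (fun s => u s x) (w2 t x) t) :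
    IsEnergySolution S u₀ u := by
  have hw1' : (fun t x => ((u t x) ^ 2)⁻¹ * (u t x ^ 2 * w1 t x)) = w1 := by
    funext t x
    exact inv_mul_cancel_left₀ (pow_ne_zero 2 (hpos t x).ne') _
  refine ⟨ae_of_all _ fun z => hpos _ _, fun t x => u t x ^ 2 * w1 t x,
    hasEnergyDeriv_of_continuous hu
      (((hu.pow 2).mul hw1).congr fun _ => rfl) hdu S, ?_, fun g hg hgS => ?_⟩
  · rw [hw1']
    exact hasEnergyDeriv_of_continuous (f := fun t x => -(u t x)⁻¹)
      (hu.inv₀ fun z => (hpos _ _).ne').neg hw1 (HasSpaceDeriv.neg_inv hpos hdu) S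
  · have hw1p : ∀ z : ℝ × UnitAddCircle, ((u z.1 z.2) ^ 2)⁻¹ * (u z.1 z.2 ^ 2 * w1 z.1 z.2) =
        w1 z.1 z.2 := fun z => congrFun (congrFun hw1' z.1) z.2
    simp only [hw1p]
    have hgc := hg.continuous
    have hA : Continuous fun z : ℝ × UnitAddCircle =>
        w2 z.1 z.2 * g z.1 z.2 + u z.1 z.2 * dt g z.1 z.2 :=
      (hw2.mul hgc).add (hu.mul hg.continuous_dt)
    have hB : Continuous fun z : ℝ × UnitAddCircle =>
        w2 z.1 z.2 * g z.1 z.2 + w1 z.1 z.2 * dx g z.1 z.2 :=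
      (hw2.mul hgc).add (hw1.mul hg.continuous_dx)
    have hBz : ∫ z, (w2 z.1 z.2 * g z.1 z.2 + w1 z.1 z.2 * dx g z.1 z.2) ∂(spaceTime S) = 0 := by
      rw [integral_spaceTime hB]
      refine integral_eq_zero_of_ae (ae_of_all _ fun t => ?_)
      exact integral_spaceDeriv_eq_zero (f := fun t x => w1 t x * g t x)
        (p := fun t x => w2 t x * g t x + w1 t x * dx g t x) hB
        (fun t y => (hdw t y).mul (hg.hasSpaceDeriv t y)) t
    have hAz : ∫ z, (w2 z.1 z.2 * g z.1 z.2 + u z.1 z.2 * dt g z.1 z.2) ∂(spaceTime S) =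
        -∫ x, u₀ x * g 0 x := by
      rw [integral_spaceTime_symm hS.le hA, ← integral_neg]
      refine integral_congr_ae (ae_of_all _ fun x => ?_)
      simp only []
      rw [intervalIntegral.integral_eq_sub_of_hasDerivAt_of_le (f := fun t => u t x * g t x) hS.le
        ((continuous_slice hu x).mul (continuous_slice hgc x)).continuousOn
        (fun t ht => (heq t ht.1 x).mul (hg.hasDerivAt_dt t x))
        ((continuous_slice (f := fun t x => w2 t x * g t x + u t x * dt g t x)
          hA x).intervalIntegrable _ _), hgS, h0]
      ring
    have : ∫ z, (u z.1 z.2 * dt g z.1 z.2 - w1 z.1 z.2 * dx g z.1 z.2) ∂(spaceTime S) =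
        -∫ x, u₀ x * g 0 x := by
      rw [← hAz, ← sub_zero (∫ z, (w2 z.1 z.2 * g z.1 z.2 + u z.1 z.2 * dt g z.1 z.2)
        ∂(spaceTime S)), ← hBz, ← integral_sub (integrable_of_continuous hA S)
        (integrable_of_continuous hB S)]
      refine integral_congr_ae (ae_of_all _ fun z => ?_)
      simp only []
      ring
    rw [this]
    ring

/-! ### Uniqueness of weak solutions with finite energy -/

theorem inner_toLp_eq_integral {X : Type*} [MeasurableSpace X] {μ : Measure X} {f g : X → ℝ}
    (hf : MemLp f 2 μ) (hg : MemLp g 2 μ) :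
    inner ℝ (hf.toLp f) (hg.toLp g) = ∫ z, f z * g z ∂μ := by
  rw [L2.inner_def]
  refine integral_congr_ae ?_
  filter_upwards [hf.coeFn_toLp, hg.coeFn_toLp] with z h1 h2
  rw [h1, h2, real_inner_eq_re_inner, RCLike.inner_apply]
  simp [mul_comm]

theorem abs_integral_mul_le {X : Type*} [MeasurableSpace X] {μ : Measure X} {f g : X → ℝ}
    (hf : MemLp f 2 μ) (hg : MemLp g 2 μ) :
    |∫ z, f z * g z ∂μ| ≤ (eLpNorm f 2 μ).toReal * (eLpNorm g 2 μ).toReal := by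
  rw [← inner_toLp_eq_integral hf hg, ← Lp.norm_toLp f hf, ← Lp.norm_toLp g hg]
  exact abs_real_inner_le_norm _ _

theorem toReal_eLpNorm_sq {X : Type*} [MeasurableSpace X] {μ : Measure X} {f : X → ℝ}
    (hf : MemLp f 2 μ) : (eLpNorm f 2 μ).toReal ^ 2 = ∫ z, f z ^ 2 ∂μ := by
  rw [← Lp.norm_toLp f hf, ← real_inner_self_eq_norm_sq, inner_toLp_eq_integral hf hf]
  simp only [sq]

theorem sq_intervalIntegral_le {f : ℝ → ℝ} (hf : Continuous f) {a b : ℝ} (hab : a ≤ b) :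
    (∫ s in a..b, f s) ^ 2 ≤ (b - a) * ∫ s in a..b, f s ^ 2 := by
  rcases hab.eq_or_lt with rfl | hlt
  · simp
  set I := ∫ s in a..b, f s with hI
  have h0 : 0 ≤ ∫ s in a..b, ((b - a) * f s - I) ^ 2 :=
    intervalIntegral.integral_nonneg hab fun s _ => sq_nonneg _
  have hi1 : IntervalIntegrable (fun s => (b - a) ^ 2 * f s ^ 2) volume a b :=
    Continuous.intervalIntegrable (by fun_prop) _ _
  have hi2 : IntervalIntegrable (fun s => 2 * (b - a) * I * f s) volume a b :=
    Continuous.intervalIntegrable (by fun_prop) _ _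
  have : ∫ s in a..b, ((b - a) * f s - I) ^ 2 =
      (b - a) ^ 2 * (∫ s in a..b, f s ^ 2) - 2 * (b - a) * I * I + I ^ 2 * (b - a) := by
    calc _ = ∫ s in a..b, ((b - a) ^ 2 * f s ^ 2 - 2 * (b - a) * I * f s + I ^ 2) := by
          congr 1; funext s; ring
      _ = _ := by
          rw [intervalIntegral.integral_add (hi1.sub hi2) intervalIntegrable_const,
            intervalIntegral.integral_sub hi1 hi2, intervalIntegral.integral_const_mul,
            intervalIntegral.integral_const_mul, ← hI, intervalIntegral.integral_const, smul_eq_mul]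
          ring
  rw [this] at h0
  have h1 : 0 ≤ (b - a) * ((b - a) * (∫ s in a..b, f s ^ 2) - I ^ 2) := by nlinarith
  have := nonneg_of_mul_nonneg_right h1 (sub_pos.2 hlt)
  linarith

section Tail

variable {f : ℝ → UnitAddCircle → ℝ} {S : ℝ}

theorem continuous_tail (hf : Continuous (Function.uncurry f)) (S : ℝ) :
    Continuous fun z : ℝ × UnitAddCircle => ∫ s in z.1..S, f s z.2 :=
  continuous_integral_slices hf (a := fun t => t) (b := fun _ => S) (by fun_prop) (by fun_prop)

/-- The operator `f ↦ ∫_t^S f` has norm at most `S` on `L²([0, S] × 𝕋)`. -/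
theorem toReal_eLpNorm_tail_le (hf : Continuous (Function.uncurry f)) (hS : 0 ≤ S) :
    (eLpNorm (fun z : ℝ × UnitAddCircle => ∫ s in z.1..S, f s z.2) 2 (spaceTime S)).toReal ≤
      S * (eLpNorm (fun z : ℝ × UnitAddCircle => f z.1 z.2) 2 (spaceTime S)).toReal := by
  have hR := continuous_tail hf S
  have hf' : Continuous fun z : ℝ × UnitAddCircle => f z.1 z.2 := hf
  have hR2 : Continuous fun z : ℝ × UnitAddCircle => (∫ s in z.1..S, f s z.2) ^ 2 := hR.pow 2
  have hf2 : Continuous fun z : ℝ × UnitAddCircle => f z.1 z.2 ^ 2 := hf'.pow 2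
  refine (pow_le_pow_iff_left₀ ENNReal.toReal_nonneg (by positivity) two_ne_zero).1 ?_
  rw [mul_pow, toReal_eLpNorm_sq (memLp_of_continuous hR S 2),
    toReal_eLpNorm_sq (memLp_of_continuous hf' S 2), integral_spaceTime_symm hS hR2,
    integral_spaceTime_symm hS hf2, ← integral_const_mul]
  have hsl := fun x => continuous_slice hf x
  have hN : Continuous fun x => ∫ t in (0 : ℝ)..S, f t x ^ 2 := by
    refine intervalIntegral.continuous_parametric_intervalIntegral_of_continuous' ?_ 0 S
    exact (hf.pow 2).comp continuous_swap
  have hN' : Continuous fun x => ∫ t in (0 : ℝ)..S, (∫ s in t..S, f s x) ^ 2 := by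
    refine intervalIntegral.continuous_parametric_intervalIntegral_of_continuous' ?_ 0 S
    exact (hR.pow 2).comp continuous_swap
  refine integral_mono (hN'.integrable_of_hasCompactSupport (HasCompactSupport.of_compactSpace _))
    ((hN.const_mul _).integrable_of_hasCompactSupport (HasCompactSupport.of_compactSpace _))
    fun x => ?_
  have hsq : Continuous fun s => f s x ^ 2 := (hsl x).pow 2
  have hpt : ∀ t ∈ Set.Icc 0 S, (∫ s in t..S, f s x) ^ 2 ≤ S * ∫ s in (0 : ℝ)..S, f s x ^ 2 := by
    intro t ht
    have h1 : ∫ s in t..S, f s x ^ 2 ≤ ∫ s in (0 : ℝ)..S, f s x ^ 2 :=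
      intervalIntegral.integral_mono_interval ht.1 ht.2 le_rfl
        (ae_of_all _ fun s => sq_nonneg _) (hsq.intervalIntegrable _ _)
    have h2 : 0 ≤ ∫ s in t..S, f s x ^ 2 :=
      intervalIntegral.integral_nonneg ht.2 fun s _ => sq_nonneg _
    calc _ ≤ (S - t) * ∫ s in t..S, f s x ^ 2 := sq_intervalIntegral_le (hsl x) ht.2
      _ ≤ S * ∫ s in (0 : ℝ)..S, f s x ^ 2 :=
        mul_le_mul (by linarith [ht.1]) h1 h2 hS
  have := intervalIntegral.integral_mono_on hS
    (((continuous_slice (f := fun t x => ∫ s in t..S, f s x) hR x).pow 2).intervalIntegrable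
      (μ := volume) 0 S)
    (intervalIntegrable_const (c := S * ∫ s in (0 : ℝ)..S, f s x ^ 2)) hpt
  refine this.trans_eq ?_
  simp
  ring

/-- The integrand is the time derivative of `-½ (∫_t^S f)²`. -/
theorem integral_mul_tail_nonneg (hf : Continuous (Function.uncurry f)) (hS : 0 ≤ S) :
    0 ≤ ∫ z, (f z.1 z.2 * ∫ s in z.1..S, f s z.2) ∂(spaceTime S) := by
  have hR := continuous_tail hf S
  have hfR : Continuous fun z : ℝ × UnitAddCircle => f z.1 z.2 * ∫ s in z.1..S, f s z.2 :=
    hf.mul hR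
  rw [integral_spaceTime_symm hS hfR]
  refine integral_nonneg fun x => ?_
  have hd : ∀ t, HasDerivAt (fun t => -(∫ s in t..S, f s x) ^ 2 / 2)
      (f t x * ∫ s in t..S, f s x) t := fun t => by
    have h1 : HasDerivAt (fun t => ∫ s in t..S, f s x) (-f t x) t := by
      have := (hasDerivAt_primitive hf S t x).neg
      refine this.congr_of_eventuallyEq (Eventually.of_forall fun t => ?_)
      exact intervalIntegral.integral_symm _ _
    refine ((h1.pow 2).neg.div_const 2).congr_deriv ?_
    push_cast
    ring
  simp only []
  rw [intervalIntegral.integral_eq_sub_of_hasDerivAt (fun t _ => hd t)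
    ((continuous_slice (f := fun t x => f t x * ∫ s in t..S, f s x)
      (hf.mul hR) x).intervalIntegrable _ _)]
  simp only [intervalIntegral.integral_same]
  have := sq_nonneg (∫ s in (0 : ℝ)..S, f s x)
  simp only [Pi.zero_apply]
  linarith

/-- The test functions `∫_t^S F` of the uniqueness proof, and their derivatives. -/
theorem IsC1.tail {F : ℝ → UnitAddCircle → ℝ} (hF : IsC1 F) (S : ℝ) :
    IsC1 (fun t x => ∫ s in t..S, F s x) ∧ dt (fun t x => ∫ s in t..S, F s x) = -F ∧
      dx (fun t x => ∫ s in t..S, F s x) = fun t x => ∫ s in t..S, dx F s x := by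
  have h1 : ∀ t x, HasDerivAt (fun t => ∫ s in t..S, F s x) (-F t x) t := fun t x => by
    have := (hasDerivAt_primitive hF.continuous S t x).neg
    refine this.congr_of_eventuallyEq (Eventually.of_forall fun t => ?_)
    exact intervalIntegral.integral_symm _ _
  have h2 := hasSpaceDeriv_integral hF.continuous hF.continuous_dx hF.hasSpaceDeriv
    (fun t => t) (fun _ => S)
  exact ⟨isC1_of_partial (gt := -F) h1 h2 hF.continuous.neg (continuous_tail hF.continuous_dx S),
    funext fun t => funext fun x => (h1 t x).deriv, h2.dx_eq⟩

end Tail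

theorem IsC1.sub {F G : ℝ → UnitAddCircle → ℝ} (hF : IsC1 F) (hG : IsC1 G) :
    IsC1 (fun t x => F t x - G t x) := ContDiff.sub hF hG

theorem IsC1.dx_sub {F G : ℝ → UnitAddCircle → ℝ} (hF : IsC1 F) (hG : IsC1 G) :
    dx (fun t x => F t x - G t x) = fun t x => dx F t x - dx G t x :=
  HasSpaceDeriv.dx_eq fun t y => (hF.hasSpaceDeriv t y).sub (hG.hasSpaceDeriv t y)

theorem HasEnergyDeriv.sub {S : ℝ} {f g p q : ℝ → UnitAddCircle → ℝ} (hf : HasEnergyDeriv S f p)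
    (hg : HasEnergyDeriv S g q) :
    HasEnergyDeriv S (fun t x => f t x - g t x) (fun t x => p t x - q t x) := by
  obtain ⟨F, hF1, hF2, hF3⟩ := hf.approx
  obtain ⟨G, hG1, hG2, hG3⟩ := hg.approx
  have key : ∀ {a b : ℕ → ℝ × UnitAddCircle → ℝ} {c : ℕ → ℝ × UnitAddCircle → ℝ},
      (∀ k, AEStronglyMeasurable (a k) (spaceTime S)) →
      (∀ k, AEStronglyMeasurable (b k) (spaceTime S)) → (∀ k, c k = a k - b k) →
      Tendsto (fun k => eLpNorm (a k) 2 (spaceTime S)) atTop (𝓝 0) →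
      Tendsto (fun k => eLpNorm (b k) 2 (spaceTime S)) atTop (𝓝 0) →
      Tendsto (fun k => eLpNorm (c k) 2 (spaceTime S)) atTop (𝓝 0) := by
    intro a b c ha hb hc h1 h2
    have h3 := h1.add h2
    rw [add_zero] at h3
    refine tendsto_of_tendsto_of_tendsto_of_le_of_le tendsto_const_nhds h3 (fun _ => zero_le)
      fun k => ?_
    simp only [hc]
    exact eLpNorm_sub_le (ha k) (hb k) (by norm_num)
  refine ⟨hf.memLp_fun.sub hg.memLp_fun, hf.memLp_deriv.sub hg.memLp_deriv,
    fun k t x => F k t x - G k t x, fun k => (hF1 k).sub (hG1 k), ?_, ?_⟩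
  · refine key (fun k => ?_) (fun k => ?_) (fun k => ?_) hF2 hG2
    · exact (hF1 k).continuous.aestronglyMeasurable.sub hf.memLp_fun.1
    · exact (hG1 k).continuous.aestronglyMeasurable.sub hg.memLp_fun.1
    · funext z; simp only [Pi.sub_apply]; ring
  · refine key (fun k => ?_) (fun k => ?_) (fun k => ?_) hF3 hG3
    · exact (hF1 k).continuous_dx.aestronglyMeasurable.sub hf.memLp_deriv.1
    · exact (hG1 k).continuous_dx.aestronglyMeasurable.sub hg.memLp_deriv.1
    · funext z; simp only [Pi.sub_apply, (hF1 k).dx_sub (hG1 k)]; ring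

/-- Abstract form of the uniqueness argument, where `d` is the difference of two solutions `u` and
`e`, `q` are the differences of `-1/u` and of its space derivative. The function to test with is
`∫_t^S e`; it is approximated by `∫_t^S F k` with `F k → e` of class `C¹`. -/
theorem integral_mul_le_zero_of_weak {S : ℝ} (hS : 0 ≤ S) {d e q : ℝ → UnitAddCircle → ℝ}
    (hd : MemLp (Function.uncurry d) 2 (spaceTime S)) (he : HasEnergyDeriv S e q)
    (hweak : ∀ g, IsC1 g → (∀ x, g S x = 0) →
      ∫ z, d z.1 z.2 * dt g z.1 z.2 ∂(spaceTime S) =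
        ∫ z, q z.1 z.2 * dx g z.1 z.2 ∂(spaceTime S)) :
    ∫ z, d z.1 z.2 * e z.1 z.2 ∂(spaceTime S) ≤ 0 := by
  obtain ⟨F, hF1, hF2, hF3⟩ := he.approx
  have he2 := he.memLp_fun
  have hq2 := he.memLp_deriv
  have hFm : ∀ k, MemLp (fun z : ℝ × UnitAddCircle => F k z.1 z.2) 2 (spaceTime S) :=
    fun k => memLp_of_continuous (hF1 k).continuous S 2
  have hfm : ∀ k, MemLp (fun z : ℝ × UnitAddCircle => dx (F k) z.1 z.2) 2 (spaceTime S) :=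
    fun k => memLp_of_continuous (hF1 k).continuous_dx S 2
  have hRm : ∀ k, MemLp (fun z : ℝ × UnitAddCircle => ∫ s in z.1..S, dx (F k) s z.2) 2
      (spaceTime S) := fun k => memLp_of_continuous (continuous_tail (hF1 k).continuous_dx S) S 2
  have hFe : ∀ k, MemLp (fun z : ℝ × UnitAddCircle => F k z.1 z.2 - e z.1 z.2) 2 (spaceTime S) :=
    fun k => (hFm k).sub he2
  have hfq : ∀ k, MemLp (fun z : ℝ × UnitAddCircle => dx (F k) z.1 z.2 - q z.1 z.2) 2
    (spaceTime S) := fun k => (hfm k).sub hq2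
  set A : ℕ → ℝ := fun k =>
    (eLpNorm (fun z => F k z.1 z.2 - e z.1 z.2) 2 (spaceTime S)).toReal with hA
  set B : ℕ → ℝ := fun k =>
    (eLpNorm (fun z => dx (F k) z.1 z.2 - q z.1 z.2) 2 (spaceTime S)).toReal with hB
  set D := (eLpNorm (Function.uncurry d) 2 (spaceTime S)).toReal with hD
  set Q := (eLpNorm (Function.uncurry q) 2 (spaceTime S)).toReal with hQ
  have hAt : Tendsto A atTop (𝓝 0) := by
    exact (ENNReal.tendsto_toReal ENNReal.zero_ne_top).comp hF2
  have hBt : Tendsto B atTop (𝓝 0) := by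
    exact (ENNReal.tendsto_toReal ENNReal.zero_ne_top).comp hF3
  have hint : ∀ {a b : ℝ × UnitAddCircle → ℝ}, MemLp a 2 (spaceTime S) →
      MemLp b 2 (spaceTime S) → Integrable (fun z => a z * b z) (spaceTime S) :=
    fun ha hb => ha.integrable_mul hb
  -- test with `∫_t^S F k`; the nonnegative term `∫∫ ∂ₓF k · ∫_t^S ∂ₓF k` is dropped
  have hbound : ∀ k, ∫ z, d z.1 z.2 * e z.1 z.2 ∂(spaceTime S) ≤
      D * A k + B k * (S * (B k + Q)) := fun k => by
    obtain ⟨hC1, hdt, hdx⟩ := (hF1 k).tail S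
    have h1 := hweak _ hC1 (fun x => intervalIntegral.integral_same)
    rw [hdt, hdx] at h1
    have h2 : ∫ z, d z.1 z.2 * (-F k) z.1 z.2 ∂(spaceTime S) =
        -∫ z, d z.1 z.2 * F k z.1 z.2 ∂(spaceTime S) := by
      rw [← integral_neg]
      refine integral_congr_ae (ae_of_all _ fun z => ?_)
      simp
    have h3 : ∫ z, d z.1 z.2 * (F k z.1 z.2 - e z.1 z.2) ∂(spaceTime S) =
        ∫ z, d z.1 z.2 * F k z.1 z.2 ∂(spaceTime S) -
          ∫ z, d z.1 z.2 * e z.1 z.2 ∂(spaceTime S) := by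
      have i1 : Integrable (fun z => d z.1 z.2 * F k z.1 z.2) (spaceTime S) := hint hd (hFm k)
      have i2 : Integrable (fun z => d z.1 z.2 * e z.1 z.2) (spaceTime S) := hint hd he2
      rw [← integral_sub i1 i2]
      simp only [mul_sub]
    have h4 : ∫ z, (dx (F k) z.1 z.2 - q z.1 z.2) * (∫ s in z.1..S, dx (F k) s z.2)
          ∂(spaceTime S) =
        ∫ z, dx (F k) z.1 z.2 * (∫ s in z.1..S, dx (F k) s z.2) ∂(spaceTime S) -
          ∫ z, q z.1 z.2 * (∫ s in z.1..S, dx (F k) s z.2) ∂(spaceTime S) := by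
      have i2 : Integrable (fun z => q z.1 z.2 * (∫ s in z.1..S, dx (F k) s z.2))
        (spaceTime S) := hint hq2 (hRm k)
      rw [← integral_sub (hint (hfm k) (hRm k)) i2]
      simp only [sub_mul]
    have h5 := integral_mul_tail_nonneg (hF1 k).continuous_dx hS
    have h6 := abs_le.1 (abs_integral_mul_le hd (hFe k))
    have h7 := abs_le.1 (abs_integral_mul_le (hfq k) (hRm k))
    have h8 := toReal_eLpNorm_tail_le (hF1 k).continuous_dx hS
    have h9 : (eLpNorm (fun z => dx (F k) z.1 z.2) 2 (spaceTime S)).toReal ≤ B k + Q := by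
      have := eLpNorm_add_le (hfq k).1 hq2.1 (p := 2) (by norm_num)
      rw [hB, hQ, ← ENNReal.toReal_add (hfq k).eLpNorm_ne_top hq2.eLpNorm_ne_top]
      refine ENNReal.toReal_mono (ENNReal.add_ne_top.2
        ⟨(hfq k).eLpNorm_ne_top, hq2.eLpNorm_ne_top⟩) (le_trans (le_of_eq ?_) this)
      congr 1
      funext z
      simp [Function.uncurry]
    have h10 : B k * (eLpNorm (fun z : ℝ × UnitAddCircle => ∫ s in z.1..S, dx (F k) s z.2) 2
        (spaceTime S)).toReal ≤ B k * (S * (B k + Q)) := by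
      have : 0 ≤ B k := ENNReal.toReal_nonneg
      gcongr
      exact h8.trans (by gcongr)
    have h6' := h6.1
    have h7' := h7.2
    simp only [Function.uncurry] at h6'
    change -(D * A k) ≤ _ at h6'
    change _ ≤ B k * _ at h7'
    linarith
  have hlim : Tendsto (fun k => D * A k + B k * (S * (B k + Q))) atTop
      (𝓝 (D * 0 + 0 * (S * (0 + Q)))) :=
    (hAt.const_mul D).add (hBt.mul ((hBt.add_const Q).const_mul S))
  have := ge_of_tendsto' hlim hbound
  simpa using this

/-- Uniqueness of weak solutions with finite energy. -/
theorem IsEnergySolution.ae_eq {S : ℝ} (hS : 0 ≤ S) {u₀ : UnitAddCircle → ℝ}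
    {u v : ℝ → UnitAddCircle → ℝ} (hu : IsEnergySolution S u₀ u) (hv : IsEnergySolution S u₀ v) :
    ∀ᵐ z ∂(spaceTime S), v z.1 z.2 = u z.1 z.2 := by
  obtain ⟨p, hup, hwp, hweak⟩ := hu.weak
  obtain ⟨p', hup', hwp', hweak'⟩ := hv.weak
  have hd : MemLp (Function.uncurry fun t x => u t x - v t x) 2 (spaceTime S) :=
    hup.memLp_fun.sub hup'.memLp_fun
  have he := hwp.sub hwp'
  have hint : ∀ {a b : ℝ × UnitAddCircle → ℝ}, MemLp a 2 (spaceTime S) →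
      MemLp b 2 (spaceTime S) → Integrable (fun z => a z * b z) (spaceTime S) :=
    fun ha hb => ha.integrable_mul hb
  have key := integral_mul_le_zero_of_weak hS hd he fun g hg hgS => by
    have h1 := hweak g hg hgS
    have h2 := hweak' g hg hgS
    have hgt := memLp_of_continuous hg.continuous_dt S 2
    have hgx := memLp_of_continuous hg.continuous_dx S 2
    have i1 := hint hup.memLp_fun hgt
    have i2 := hint hwp.memLp_deriv hgx
    have i1' := hint hup'.memLp_fun hgt
    have i2' := hint hwp'.memLp_deriv hgx
    simp only [Function.uncurry] at i1 i2 i1' i2'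
    rw [integral_sub i1 i2] at h1
    rw [integral_sub i1' i2'] at h2
    simp only [sub_mul]
    rw [integral_sub i1 i1', integral_sub i2 i2']
    linarith
  have hnn : 0 ≤ᵐ[spaceTime S] fun z => (u z.1 z.2 - v z.1 z.2) *
      (-(u z.1 z.2)⁻¹ - -(v z.1 z.2)⁻¹) := by
    filter_upwards [hu.pos, hv.pos] with z h1 h2
    have : (u z.1 z.2 - v z.1 z.2) * (-(u z.1 z.2)⁻¹ - -(v z.1 z.2)⁻¹) =
      (u z.1 z.2 - v z.1 z.2) ^ 2 * ((u z.1 z.2)⁻¹ * (v z.1 z.2)⁻¹) := by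
      field_simp
      ring
    rw [this]
    simp only [Pi.zero_apply]
    positivity
  have h0 := (integral_eq_zero_iff_of_nonneg_ae hnn (hint hd he.memLp_fun)).1
    (le_antisymm key (integral_nonneg_of_ae hnn))
  filter_upwards [h0, hu.pos, hv.pos] with z hz h1 h2
  have : (u z.1 z.2 - v z.1 z.2) ^ 2 * ((u z.1 z.2)⁻¹ * (v z.1 z.2)⁻¹) = 0 := by
    rw [← show _ = (0 : ℝ) from hz]
    field_simp
    ring
  have h3 := (mul_eq_zero.1 this).resolve_right (by positivity)
  exact (sub_eq_zero.1 (pow_eq_zero_iff two_ne_zero |>.1 h3)).symm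

/-! ### The discrete system -/

/-- Maximum principle for finitely many functions of time: they remain nonpositive if, whenever the
largest one is positive, its derivative is at most `K` times its value. -/
theorem le_zero_of_forall_max {ι : Type*} [Finite ι] {f f' : ℝ → ι → ℝ} {T K : ℝ}
    (hc : ∀ x, ContinuousOn (fun t => f t x) (Set.Icc 0 T))
    (hd : ∀ t ∈ Set.Ioc 0 T, ∀ x, HasDerivAt (fun s => f s x) (f' t x) t)
    (h0 : ∀ x, f 0 x ≤ 0)
    (hmax : ∀ t ∈ Set.Ioc 0 T, ∀ x, (∀ y, f t y ≤ f t x) → 0 < f t x → f' t x ≤ K * f t x)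
    {t : ℝ} (ht : t ∈ Set.Icc 0 T) (x : ι) : f t x ≤ 0 := by
  have hT : 0 ≤ T := ht.1.trans ht.2
  -- the factor makes the derivative strictly negative at a positive maximum
  set g : ℝ → ι → ℝ := fun t x => Real.exp (-(K + 1) * t) * f t x with hg
  have hgc : ∀ x, ContinuousOn (fun t => g t x) (Set.Icc 0 T) := fun x =>
    (Continuous.continuousOn (by fun_prop)).mul (hc x)
  choose τ hτ hτmax using fun x => isCompact_Icc.exists_isMaxOn
    (Set.nonempty_Icc.2 hT) (hgc x)
  have : Nonempty ι := ⟨x⟩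
  obtain ⟨x₀, hx₀⟩ := Finite.exists_max fun x => g (τ x) x
  set t₀ := τ x₀
  have hle : ∀ s ∈ Set.Icc 0 T, ∀ y, g s y ≤ g t₀ x₀ := fun s hs y =>
    (hτmax y hs).trans (hx₀ y)
  by_contra! hpos
  have hgpos : 0 < g t₀ x₀ := (mul_pos (Real.exp_pos _) hpos).trans_le (hle t ht x)
  have hf0 : 0 < f t₀ x₀ := pos_of_mul_pos_right hgpos (Real.exp_pos _).le
  have ht₀ : t₀ ∈ Set.Ioc 0 T := by
    refine ⟨(hτ x₀).1.lt_of_ne fun h => ?_, (hτ x₀).2⟩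
    rw [show t₀ = 0 from h.symm] at hf0
    exact absurd hf0 (not_lt.2 (h0 x₀))
  have hfle : f' t₀ x₀ ≤ K * f t₀ x₀ := hmax t₀ ht₀ x₀ (fun y =>
    le_of_mul_le_mul_left (hle t₀ (hτ x₀) y) (Real.exp_pos _)) hf0
  have hexp : HasDerivAt (fun t => Real.exp (-(K + 1) * t))
      (Real.exp (-(K + 1) * t₀) * -(K + 1)) t₀ := by
    simpa using ((hasDerivAt_id t₀).const_mul (-(K + 1))).exp
  have hgd := hexp.mul (hd t₀ ht₀ x₀)
  have hnonneg : 0 ≤ Real.exp (-(K + 1) * t₀) * -(K + 1) * f t₀ x₀ +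
      Real.exp (-(K + 1) * t₀) * f' t₀ x₀ := by
    have h1 := (hasDerivAt_iff_tendsto_slope.1 hgd).mono_left
      (nhdsWithin_mono t₀ (fun s (hs : s < t₀) => hs.ne) : 𝓝[<] t₀ ≤ 𝓝[≠] t₀)
    refine ge_of_tendsto h1 ?_
    filter_upwards [Ioo_mem_nhdsLT ht₀.1] with s hs
    have := hle s ⟨hs.1.le, hs.2.le.trans ht₀.2⟩ x₀
    rw [slope_def_field]
    exact div_nonneg_of_nonpos (sub_nonpos.2 this) (sub_nonpos.2 hs.2.le)
  nlinarith [Real.exp_pos (-(K + 1) * t₀), mul_pos (Real.exp_pos (-(K + 1) * t₀)) hf0,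
    mul_le_mul_of_nonneg_left hfle (Real.exp_pos (-(K + 1) * t₀)).le]

/-- Global solutions for a bounded Lipschitz vector field. Boundedness of the field lets the
Picard–Lindelöf theorem reach every interval `[0, N]`; the solutions obtained agree with each other. -/
theorem exists_global_solution {E : Type*} [NormedAddCommGroup E] [NormedSpace ℝ E]
    [CompleteSpace E] {F : E → E} {K L : NNReal} (hF : LipschitzWith K F) (hL : ∀ x, ‖F x‖ ≤ L)
    (x₀ : E) : ∃ U : ℝ → E, U 0 = x₀ ∧
      ∀ t, 0 ≤ t → HasDerivWithinAt U (F (U t)) (Set.Ici 0) t := by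
  have hloc : ∀ N : ℕ, ∃ A : ℝ → E, A 0 = x₀ ∧
      ∀ t ∈ Set.Icc (0 : ℝ) N, HasDerivWithinAt A (F (A t)) (Set.Icc 0 (N : ℝ)) t := fun N => by
    have : IsPicardLindelof (fun _ => F) (tmin := 0) (tmax := N)
        ⟨0, ⟨le_rfl, Nat.cast_nonneg N⟩⟩ x₀ (L * N) 0 L K :=
      ⟨fun _ _ => hF.lipschitzOnWith, fun _ _ => continuousOn_const, fun _ _ x _ => hL x, by simp⟩
    exact this.exists_eq_forall_mem_Icc_hasDerivWithinAt₀
  choose A hA0 hA using hloc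
  have hcont : ∀ N, ContinuousOn (A N) (Set.Icc 0 (N : ℝ)) := fun N t ht =>
    (hA N t ht).continuousWithinAt
  have hright : ∀ N : ℕ, ∀ t ∈ Set.Ico (0 : ℝ) N,
      HasDerivWithinAt (A N) (F (A N t)) (Set.Ici t) t := fun N t ht =>
    ((hA N t ⟨ht.1, ht.2.le⟩).mono
      (Set.Icc_subset_Icc_left ht.1)).mono_of_mem_nhdsWithin (Icc_mem_nhdsGE ht.2)
  have hagree : ∀ {M N : ℕ}, M ≤ N → Set.EqOn (A M) (A N) (Set.Icc 0 (M : ℝ)) := fun {M N} hMN => by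
    have hMN' : (M : ℝ) ≤ N := by exact_mod_cast hMN
    refine ODE_solution_unique (v := fun _ => F) (fun _ => hF) (hcont M) (hright M)
      ((hcont N).mono (Set.Icc_subset_Icc_right hMN'))
      (fun t ht => hright N t ⟨ht.1, ht.2.trans_le hMN'⟩) (by rw [hA0, hA0])
  refine ⟨fun t => A (⌈t⌉₊ + 1) t, by simp [hA0], fun t ht => ?_⟩
  set m := ⌈t⌉₊ + 2 with hm
  have htm : t + 1 < m := by
    have := Nat.le_ceil t
    rw [hm]; push_cast; linarith
  have heq : ∀ s ∈ Set.Ico 0 (t + 1), A (⌈s⌉₊ + 1) s = A m s := fun s hs => by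
    have h1 : ⌈s⌉₊ ≤ ⌈t⌉₊ + 1 := by
      rw [← Nat.ceil_add_one ht]; exact Nat.ceil_mono hs.2.le
    refine hagree (by omega) ⟨hs.1, ?_⟩
    have := Nat.le_ceil s
    push_cast; linarith
  have hd : HasDerivWithinAt (A m) (F (A m t)) (Set.Ici 0) t :=
    (hA m t ⟨ht, by linarith⟩).mono_of_mem_nhdsWithin (by
      have : Set.Iio (m : ℝ) ∈ 𝓝 t := Iio_mem_nhds (by linarith)
      filter_upwards [self_mem_nhdsWithin, mem_nhdsWithin_of_mem_nhds this] with s hs1 hs2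
      exact ⟨hs1, (Set.mem_Iio.1 hs2).le⟩)
  have ht1 : t ∈ Set.Ico 0 (t + 1) := ⟨ht, by linarith⟩
  have hev : (fun t => A (⌈t⌉₊ + 1) t) =ᶠ[𝓝[Set.Ici 0] t] A m := by
    filter_upwards [self_mem_nhdsWithin, mem_nhdsWithin_of_mem_nhds
      (Iio_mem_nhds (show t < t + 1 by linarith))] with s hs1 hs2
    exact heq s ⟨hs1, hs2⟩
  refine (hd.congr_of_eventuallyEq hev (heq t ht1)).congr_deriv ?_
  simp only [heq t ht1]

theorem discreteLaplacian_nonneg_of_isMin (n : ℕ+) {f : ZMod n → ℝ} {x : ZMod n}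
    (h : ∀ y, f x ≤ f y) : 0 ≤ discreteLaplacian n f x := by
  have h1 := h (x + 1)
  have h2 := h (x - 1)
  exact mul_nonneg (by positivity) (by linarith)

theorem discreteLaplacian_nonpos_of_isMax (n : ℕ+) {f : ZMod n → ℝ} {x : ZMod n}
    (h : ∀ y, f y ≤ f x) : discreteLaplacian n f x ≤ 0 := by
  have h1 := h (x + 1)
  have h2 := h (x - 1)
  exact mul_nonpos_of_nonneg_of_nonpos (by positivity) (by linarith)

theorem rpow_pos (α : ℝ) (n : ℕ+) : 0 < ((n : ℕ) : ℝ) ^ α :=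
  Real.rpow_pos_of_pos (by exact_mod_cast n.pos) α

/-- With `δ = n ^ (-α)`, `φ_n(u) = n ^ α - 1 / (δ + u)`. -/
theorem phiN_eq (α : ℝ) (n : ℕ+) {u : ℝ} (hu : 0 ≤ u) :
    phiN α n u = ((n : ℕ) : ℝ) ^ α - ((((n : ℕ) : ℝ) ^ α)⁻¹ + u)⁻¹ := by
  have hN := rpow_pos α n
  unfold phiN phi
  generalize ((n : ℕ) : ℝ) ^ α = N at hN
  have h1 : 1 + N * u ≠ 0 := by positivity
  have h2 : N⁻¹ + u = (1 + N * u) / N := by field_simp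
  rw [h2]
  field_simp
  ring

/-- `φ_n` extended by zero to negative arguments. -/
noncomputable def truncPhiN (α : ℝ) (n : ℕ+) (u : ℝ) : ℝ := phiN α n (max u 0)

theorem truncPhiN_mono (α : ℝ) (n : ℕ+) : Monotone (truncPhiN α n) := fun a b hab => by
  have hN := rpow_pos α n
  unfold truncPhiN
  rw [phiN_eq α n (le_max_right _ _), phiN_eq α n (le_max_right _ _)]
  have : 0 ≤ max a 0 := le_max_right _ _
  gcongr

theorem abs_truncPhiN_le (α : ℝ) (n : ℕ+) (u : ℝ) : |truncPhiN α n u| ≤ ((n : ℕ) : ℝ) ^ α := by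
  have hN := rpow_pos α n
  have h0 : 0 ≤ max u 0 := le_max_right _ _
  have h1 : (0 : ℝ) ≤ ((((n : ℕ) : ℝ) ^ α)⁻¹ + max u 0)⁻¹ := by positivity
  have h2 : ((((n : ℕ) : ℝ) ^ α)⁻¹ + max u 0)⁻¹ ≤ ((n : ℕ) : ℝ) ^ α :=
    inv_le_of_inv_le₀ hN (by linarith)
  unfold truncPhiN
  rw [phiN_eq α n h0, abs_le]
  constructor <;> linarith

theorem abs_truncPhiN_sub_le (α : ℝ) (n : ℕ+) (a b : ℝ) :
    |truncPhiN α n a - truncPhiN α n b| ≤ (((n : ℕ) : ℝ) ^ α) ^ 2 * |a - b| := by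
  have hN := rpow_pos α n
  have ha : 0 ≤ max a 0 := le_max_right _ _
  have hb : 0 ≤ max b 0 := le_max_right _ _
  have hab : |max a 0 - max b 0| ≤ |a - b| := abs_max_sub_max_le_abs a b 0
  unfold truncPhiN
  rw [phiN_eq α n ha, phiN_eq α n hb]
  generalize max a 0 = a' at *
  generalize max b 0 = b' at *
  generalize ((n : ℕ) : ℝ) ^ α = N at hN
  have h1 : N - (N⁻¹ + a')⁻¹ - (N - (N⁻¹ + b')⁻¹) =
      (N⁻¹ + a')⁻¹ * (N⁻¹ + b')⁻¹ * (a' - b') := by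
    have h1 : N⁻¹ + a' ≠ 0 := by positivity
    have h2 : N⁻¹ + b' ≠ 0 := by positivity
    calc _ = (N⁻¹ + b')⁻¹ - (N⁻¹ + a')⁻¹ := by ring
      _ = _ := by rw [inv_sub_inv h2 h1, div_eq_mul_inv, mul_inv]; ring
  have h2 : ∀ {c : ℝ}, 0 ≤ c → (N⁻¹ + c)⁻¹ ≤ N := fun hc =>
    inv_le_of_inv_le₀ hN (by linarith)
  rw [h1, abs_mul, abs_of_nonneg (by positivity : 0 ≤ (N⁻¹ + a')⁻¹ * (N⁻¹ + b')⁻¹)]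
  calc _ ≤ (N * N) * |a - b| := by
        gcongr
        · exact h2 ha
        · exact h2 hb
    _ = _ := by ring

/-- The vector field of the discrete system, with `φ_n` extended by zero. -/
noncomputable def truncField (α : ℝ) (n : ℕ+) (f : ZMod n → ℝ) (x : ZMod n) : ℝ :=
  discreteLaplacian n (fun y => truncPhiN α n (f y)) x

theorem truncField_eq (α : ℝ) (n : ℕ+) {f : ZMod n → ℝ} (hf : ∀ x, 0 ≤ f x) :
    truncField α n f = discreteLaplacian n (fun y => phiN α n (f y)) := by
  funext x
  simp only [truncField, truncPhiN, max_eq_left (hf _)]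

theorem abs_laplacian_le (n : ℕ+) {f : ZMod n → ℝ} {C : ℝ} (h : ∀ y, |f y| ≤ C) (x : ZMod n) :
    |discreteLaplacian n f x| ≤ ((n : ℕ) : ℝ) ^ 2 * (4 * C) := by
  unfold discreteLaplacian
  rw [abs_mul, abs_of_nonneg (by positivity : 0 ≤ ((n : ℕ) : ℝ) ^ 2)]
  have h1 := abs_le.1 (h (x + 1))
  have h2 := abs_le.1 (h (x - 1))
  have h3 := abs_le.1 (h x)
  gcongr
  rw [abs_le]
  constructor <;> linarith

theorem discreteLaplacian_sub (n : ℕ+) (f g : ZMod n → ℝ) (x : ZMod n) :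
    discreteLaplacian n (fun y => f y - g y) x =
      discreteLaplacian n f x - discreteLaplacian n g x := by
  unfold discreteLaplacian
  ring

theorem norm_truncField_le (α : ℝ) (n : ℕ+) (f : ZMod n → ℝ) :
    ‖truncField α n f‖ ≤ ((n : ℕ) : ℝ) ^ 2 * (4 * ((n : ℕ) : ℝ) ^ α) := by
  have hN := rpow_pos α n
  refine (pi_norm_le_iff_of_nonneg (by positivity)).2 fun x => ?_
  exact abs_laplacian_le n (fun y => abs_truncPhiN_le α n (f y)) x

theorem lipschitzWith_truncField (α : ℝ) (n : ℕ+) : LipschitzWith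
    (Real.toNNReal (((n : ℕ) : ℝ) ^ 2 * (4 * (((n : ℕ) : ℝ) ^ α) ^ 2))) (truncField α n) := by
  refine LipschitzWith.of_dist_le_mul fun f g => ?_
  rw [Real.coe_toNNReal _ (by positivity)]
  refine (dist_pi_le_iff (by positivity)).2 fun x => ?_
  rw [Real.dist_eq]
  unfold truncField
  rw [← discreteLaplacian_sub]
  refine (abs_laplacian_le n (C := (((n : ℕ) : ℝ) ^ α) ^ 2 * dist f g) (fun y => ?_) x).trans_eq
    (by ring)
  refine (abs_truncPhiN_sub_le α n (f y) (g y)).trans ?_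
  gcongr
  rw [← Real.dist_eq]
  exact dist_le_pi_dist f g y

/-- The discrete flow stays between the bounds of its initial data. -/
theorem mem_Icc_of_truncField {α : ℝ} {n : ℕ+} {U : ℝ → ZMod n → ℝ}
    (hU : ∀ t, 0 ≤ t → ∀ x, HasDerivWithinAt (fun s => U s x) (truncField α n (U t) x)
      (Set.Ici 0) t) {a b : ℝ} (h0 : ∀ x, U 0 x ∈ Set.Icc a b) {t : ℝ} (ht : 0 ≤ t) (x : ZMod n) :
    U t x ∈ Set.Icc a b := by
  have hc : ∀ x, ContinuousOn (fun s => U s x) (Set.Icc 0 t) := fun x s hs =>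
    ((hU s hs.1 x).continuousWithinAt).mono Set.Icc_subset_Ici_self
  have hd : ∀ s ∈ Set.Ioc 0 t, ∀ x, HasDerivAt (fun s => U s x) (truncField α n (U s) x) s :=
    fun s hs x => (hU s hs.1.le x).hasDerivAt (Ici_mem_nhds hs.1)
  constructor
  · have := le_zero_of_forall_max (f := fun t x => a - U t x) (K := 0)
      (fun x => continuousOn_const.sub (hc x)) (fun s hs x => (hd s hs x).const_sub a)
      (fun x => sub_nonpos.2 (h0 x).1) (fun s hs x hmax _ => by
        rw [zero_mul, neg_nonpos]
        exact discreteLaplacian_nonneg_of_isMin n fun y =>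
          truncPhiN_mono α n (by linarith [hmax y])) ⟨ht, le_rfl⟩ x
    linarith
  · have := le_zero_of_forall_max (f := fun t x => U t x - b) (K := 0)
      (fun x => (hc x).sub continuousOn_const) (fun s hs x => (hd s hs x).sub_const b)
      (fun x => sub_nonpos.2 (h0 x).2) (fun s hs x hmax _ => by
        rw [zero_mul]
        exact discreteLaplacian_nonpos_of_isMax n fun y =>
          truncPhiN_mono α n (by linarith [hmax y])) ⟨ht, le_rfl⟩ x
    linarith

theorem IsDiscreteSolution.truncField {α : ℝ} {u₀ : UnitAddCircle → ℝ} {n : ℕ+}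
    {U : ℝ → ZMod n → ℝ} (h : IsDiscreteSolution α u₀ n U) (t : ℝ) (ht : 0 ≤ t) (x : ZMod n) :
    HasDerivWithinAt (fun s => U s x) (truncField α n (U t) x) (Set.Ici 0) t := by
  rw [truncField_eq α n (h.nonneg t ht)]
  exact h.ode t ht x

theorem exists_isDiscreteSolution (α : ℝ) {u₀ : UnitAddCircle → ℝ} (hu₀ : ∀ x, 0 ≤ u₀ x)
    (n : ℕ+) : ∃ U, IsDiscreteSolution α u₀ n U := by
  obtain ⟨U, hU0, hU⟩ := exists_global_solution (L := Real.toNNReal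
    (((n : ℕ) : ℝ) ^ 2 * (4 * ((n : ℕ) : ℝ) ^ α))) (lipschitzWith_truncField α n)
    (fun f => (norm_truncField_le α n f).trans (Real.le_coe_toNNReal _))
    (fun x => u₀ (ZMod.toAddCircle x))
  have hU' := fun t ht => hasDerivWithinAt_pi.1 (hU t ht)
  obtain ⟨b, hb⟩ := (Set.finite_range (U 0)).bddAbove
  have hnn : ∀ t, 0 ≤ t → ∀ x, 0 ≤ U t x := fun t ht x =>
    (mem_Icc_of_truncField (a := 0) (b := b) hU' (fun x => ⟨by rw [hU0]; exact hu₀ _,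
      hb ⟨x, rfl⟩⟩) ht x).1
  refine ⟨U, hnn, fun x => by rw [hU0], fun t ht x => ?_⟩
  rw [← truncField_eq α n (hnn t ht)]
  exact hU' t ht x

theorem IsDiscreteSolution.unique {α : ℝ} {u₀ : UnitAddCircle → ℝ} {n : ℕ+}
    {U V : ℝ → ZMod n → ℝ} (hU : IsDiscreteSolution α u₀ n U) (hV : IsDiscreteSolution α u₀ n V)
    {t : ℝ} (ht : 0 ≤ t) : V t = U t := by
  have hd : ∀ {W : ℝ → ZMod n → ℝ}, IsDiscreteSolution α u₀ n W → ∀ s, 0 ≤ s →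
      HasDerivWithinAt W (FastDiffusion.truncField α n (W s)) (Set.Ici 0) s := fun hW s hs =>
    hasDerivWithinAt_pi.2 fun x => hW.truncField s hs x
  refine ODE_solution_unique (a := 0) (b := t) (v := fun _ => FastDiffusion.truncField α n)
    (fun _ => lipschitzWith_truncField α n) (fun s hs => ?_) (fun s hs => ?_) (fun s hs => ?_)
    (fun s hs => ?_) ?_ ⟨ht, le_rfl⟩
  · exact ((hd hV s hs.1).continuousWithinAt).mono Set.Icc_subset_Ici_self
  · exact (hd hV s hs.1).mono (Set.Ici_subset_Ici.2 hs.1)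
  · exact ((hd hU s hs.1).continuousWithinAt).mono Set.Icc_subset_Ici_self
  · exact (hd hU s hs.1).mono (Set.Ici_subset_Ici.2 hs.1)
  · funext x
    rw [hU.initial, hV.initial]

/-! ### Consistency and stability of the discretization -/

/-- Taylor bound for the second difference quotient in terms of the oscillation of the second
derivative; the constant is not optimal. -/
theorem abs_second_difference_sub_le {w w1 w2 : ℝ → ℝ} (h1 : ∀ y, HasDerivAt w (w1 y) y)
    (h2 : ∀ y, HasDerivAt w1 (w2 y) y) {x h ω : ℝ} (hh : 0 ≤ h)
    (hω : ∀ y, |y - x| ≤ h → |w2 y - w2 x| ≤ ω) :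
    |w (x + h) + w (x - h) - 2 * w x - h ^ 2 * w2 x| ≤ 2 * ω * h ^ 2 := by
  have hω0 : 0 ≤ ω := (abs_nonneg _).trans (hω x (by simpa using hh))
  have hq : ∀ s, HasDerivAt (fun s => w (x + s) + w (x - s) - 2 * w x - s ^ 2 * w2 x)
      (w1 (x + s) - w1 (x - s) - 2 * s * w2 x) s := fun s => by
    refine (((((h1 _).comp_const_add x s).add ((h1 _).comp_const_sub x s)).sub_const
      (2 * w x)).sub (((hasDerivAt_id s).pow 2).mul_const (w2 x))).congr_deriv ?_
    simp
    ring
  have hq1 : ∀ s, HasDerivAt (fun s => w1 (x + s) - w1 (x - s) - 2 * s * w2 x)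
      (w2 (x + s) + w2 (x - s) - 2 * w2 x) s := fun s => by
    refine ((((h2 _).comp_const_add x s).sub ((h2 _).comp_const_sub x s)).sub
      (((hasDerivAt_id s).const_mul 2).mul_const (w2 x))).congr_deriv ?_
    simp
  have hb1 : ∀ s ∈ Set.Icc 0 h, |w1 (x + s) - w1 (x - s) - 2 * s * w2 x| ≤ 2 * ω * h := by
    intro s hs
    have := (convex_Icc 0 h).norm_image_sub_le_of_norm_hasDerivWithin_le (C := 2 * ω)
      (fun s _ => (hq1 s).hasDerivWithinAt) (fun s hs => by
        have e1 := abs_le.1 (hω (x + s) (by simpa [abs_of_nonneg hs.1] using hs.2))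
        have e2 := abs_le.1 (hω (x - s) (by
          rw [sub_sub_cancel_left, abs_neg, abs_of_nonneg hs.1]; exact hs.2))
        rw [Real.norm_eq_abs, abs_le]
        constructor <;> linarith) (x := 0) (y := s) ⟨le_rfl, hh⟩ hs
    simp only [add_zero, sub_zero, sub_self, mul_zero, zero_mul, Real.norm_eq_abs,
      abs_of_nonneg hs.1] at this
    exact this.trans (by gcongr; exact hs.2)
  have := (convex_Icc 0 h).norm_image_sub_le_of_norm_hasDerivWithin_le
      (fun s _ => (hq s).hasDerivWithinAt) hb1 (x := 0) (y := h) ⟨le_rfl, hh⟩ ⟨hh, le_rfl⟩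
  have h0 : w x + w x - 2 * w x = 0 := by ring
  simp only [add_zero, sub_zero, ne_eq, OfNat.ofNat_ne_zero, not_false_eq_true, zero_pow,
    zero_mul, h0, Real.norm_eq_abs, abs_of_nonneg hh] at this
  refine this.trans_eq ?_
  ring

theorem abs_laplacian_sub_le {w w1 w2 : ℝ → UnitAddCircle → ℝ} (h1 : HasSpaceDeriv w w1)
    (h2 : HasSpaceDeriv w1 w2) (n : ℕ+) {t ω : ℝ}
    (hω : ∀ (x : UnitAddCircle) (h : ℝ), |h| ≤ (((n : ℕ) : ℝ))⁻¹ →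
      |w2 t (x + (h : UnitAddCircle)) - w2 t x| ≤ ω) (x : ZMod n) :
    |discreteLaplacian n (fun y => w t (ZMod.toAddCircle y)) x - w2 t (ZMod.toAddCircle x)| ≤
      2 * ω := by
  have hn : (0 : ℝ) < (n : ℕ) := by exact_mod_cast n.pos
  obtain ⟨y, hy⟩ := QuotientAddGroup.mk_surjective (ZMod.toAddCircle x : UnitAddCircle)
  have hy' : ZMod.toAddCircle x = (y : UnitAddCircle) := hy.symm
  have hone : ZMod.toAddCircle (1 : ZMod n) = (((((n : ℕ) : ℝ))⁻¹ : ℝ) : UnitAddCircle) := by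
    have := ZMod.toAddCircle_natCast (N := n) 1
    simpa using this
  have key := abs_second_difference_sub_le (h1 t) (h2 t) (x := y) (h := (((n : ℕ) : ℝ))⁻¹)
    (ω := ω) (by positivity) (fun z hz => by
      have := hω y (z - y) hz
      rwa [← AddCircle.coe_add, add_sub_cancel] at this)
  simp only [discreteLaplacian, map_add, map_sub, hone, hy', ← AddCircle.coe_add,
    ← AddCircle.coe_sub]
  generalize w t _ + w t _ - 2 * w t _ = A at *
  generalize w2 t _ = B at *
  have e : ((n : ℕ) : ℝ) ^ 2 * A - B = ((n : ℕ) : ℝ) ^ 2 * (A - (((n : ℕ) : ℝ))⁻¹ ^ 2 * B) := by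
    field_simp
  rw [e, abs_mul, abs_of_nonneg (by positivity : 0 ≤ ((n : ℕ) : ℝ) ^ 2)]
  refine (mul_le_mul_of_nonneg_left key (by positivity)).trans_eq ?_
  field_simp

theorem eventually_abs_shift_sub_le {f : ℝ → UnitAddCircle → ℝ}
    (hf : Continuous (Function.uncurry f)) (S : ℝ) {η : ℝ} (hη : 0 < η) :
    ∀ᶠ h : ℝ in 𝓝 0, ∀ t ∈ Set.Icc 0 S, ∀ x, |f t (x + (h : UnitAddCircle)) - f t x| ≤ η := by
  have hc : Continuous (fun q : ℝ × (Set.Icc (0 : ℝ) S × UnitAddCircle) =>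
      f q.2.1 (q.2.2 + (q.1 : UnitAddCircle))) :=
    hf.comp (f := fun q : ℝ × (Set.Icc (0 : ℝ) S × UnitAddCircle) =>
      ((q.2.1 : ℝ), q.2.2 + (q.1 : UnitAddCircle)))
      ((by fun_prop : Continuous _).prodMk ((by fun_prop : Continuous _).add
        ((AddCircle.continuous_mk' 1).comp continuous_fst)))
  have := Continuous.tendstoUniformly
    (fun (h : ℝ) (q : Set.Icc (0 : ℝ) S × UnitAddCircle) => f q.1 (q.2 + (h : UnitAddCircle))) hc 0
  rw [Metric.tendstoUniformly_iff] at this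
  filter_upwards [this η hη] with h hh t ht x
  have := hh (⟨t, ht⟩, x)
  rw [dist_comm, Real.dist_eq] at this
  simpa using this.le

/-- Stability of the discrete equation `∂ₜ E = c Δ_n E + O(|E|) + O(b)`: comparison of `± E` with
`(a + b t) exp (C t)` by the maximum principle. -/
theorem abs_le_of_discrete_parabolic {n : ℕ+} {E E' c : ℝ → ZMod n → ℝ} {T a b C : ℝ}
    (ha : 0 ≤ a) (hb : 0 ≤ b) (hC : 0 ≤ C)
    (hcont : ∀ x, ContinuousOn (fun t => E t x) (Set.Icc 0 T))
    (hd : ∀ t ∈ Set.Ioc 0 T, ∀ x, HasDerivAt (fun s => E s x) (E' t x) t)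
    (hc : ∀ t x, 0 ≤ c t x) (h0 : ∀ x, |E 0 x| ≤ a)
    (hE : ∀ t ∈ Set.Ioc 0 T, ∀ x,
      |E' t x - c t x * discreteLaplacian n (E t) x| ≤ C * |E t x| + b)
    {t : ℝ} (ht : t ∈ Set.Icc 0 T) (x : ZMod n) : |E t x| ≤ (a + b * t) * Real.exp (C * t) := by
  have hm : ∀ t, HasDerivAt (fun t => (a + b * t) * Real.exp (C * t))
      (b * Real.exp (C * t) + C * ((a + b * t) * Real.exp (C * t))) t := fun t => by
    have h1 : HasDerivAt (fun t => a + b * t) b t := by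
      simpa using ((hasDerivAt_id t).const_mul b).const_add a
    have h2 : HasDerivAt (fun t => Real.exp (C * t)) (Real.exp (C * t) * C) t := by
      simpa using ((hasDerivAt_id t).const_mul C).exp
    exact (h1.mul h2).congr_deriv (by ring)
  have hmc : Continuous fun t => (a + b * t) * Real.exp (C * t) := by fun_prop
  have key : ∀ σ : ℝ, |σ| = 1 → σ * E t x ≤ (a + b * t) * Real.exp (C * t) := fun σ hσ => by
    have hle : ∀ z : ℝ, σ * z ≤ |z| := fun z =>
      (le_abs_self _).trans_eq (by rw [abs_mul, hσ, one_mul])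
    have := le_zero_of_forall_max (K := C)
      (f := fun t x => σ * E t x - (a + b * t) * Real.exp (C * t))
      (fun x => (continuousOn_const.mul (hcont x)).sub hmc.continuousOn)
      (fun t ht x => ((hd t ht x).const_mul σ).sub (hm t))
      (fun x => by simpa using (hle _).trans (h0 x))
      (fun t ht x hmax hpos => by
        have hm0 : 0 ≤ (a + b * t) * Real.exp (C * t) := by
          have := ht.1.le
          positivity
        have hexp : 1 ≤ Real.exp (C * t) := Real.one_le_exp (mul_nonneg hC ht.1.le)
        have hL : discreteLaplacian n (fun y => σ * E t y) x ≤ 0 :=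
          discreteLaplacian_nonpos_of_isMax n fun y => by linarith [hmax y]
        have hL' : discreteLaplacian n (fun y => σ * E t y) x =
            σ * discreteLaplacian n (E t) x := by unfold discreteLaplacian; ring
        have habs : |E t x| = σ * E t x := by
          rw [← one_mul |E t x|, ← hσ, ← abs_mul, abs_of_pos (by linarith)]
        have h1 := (hle _).trans (hE t ht x)
        rw [habs] at h1
        rw [hL'] at hL
        have h2 := mul_nonpos_of_nonneg_of_nonpos (hc t x) hL
        have h3 : b ≤ b * Real.exp (C * t) := le_mul_of_one_le_right hb hexp
        linarith) ht x
    linarith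
  rw [abs_le']
  exact ⟨by simpa using key 1 (by simp), by simpa using key (-1) (by simp)⟩

/-- Quantitative comparison of the discrete and the classical solution, in terms of
`δ = n ^ (-α)` and of the oscillation `ω` of `w2 = ∂ₓ² (-1/u)` over distances up to `1 / n`. The
estimate is made for the reciprocals `-1/(u^n + δ)` and `-1/u`, by consistency of the discrete
Laplacian and `abs_le_of_discrete_parabolic`. -/
theorem abs_discrete_sub_le {α : ℝ} {u₀ : UnitAddCircle → ℝ} {n : ℕ+} {U : ℝ → ZMod n → ℝ}
    (hU : IsDiscreteSolution α u₀ n U) {u w1 w2 : ℝ → UnitAddCircle → ℝ}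
    (hu : Continuous (Function.uncurry u)) (h0 : ∀ x, u 0 x = u₀ x)
    (hdw : HasSpaceDeriv (fun t x => -(u t x)⁻¹) w1) (hdw1 : HasSpaceDeriv w1 w2)
    (heq : ∀ t, 0 < t → ∀ x, HasDerivAt (fun s => u s x) (w2 t x) t)
    {m K B ω T : ℝ} (hm : 0 < m) (hmK : ∀ t x, u t x ∈ Set.Icc m K)
    (hB : ∀ t ∈ Set.Icc 0 T, ∀ x, |w2 t x| ≤ B) (hω0 : 0 ≤ ω)
    (hω : ∀ t ∈ Set.Icc 0 T, ∀ (x : UnitAddCircle) (h : ℝ), |h| ≤ (((n : ℕ) : ℝ))⁻¹ →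
      |w2 t (x + (h : UnitAddCircle)) - w2 t x| ≤ ω)
    {t : ℝ} (ht : t ∈ Set.Icc 0 T) (x : ZMod n) :
    |U t x - u t (ZMod.toAddCircle x)| ≤
      (K + (((n : ℕ) : ℝ) ^ α)⁻¹) ^ 2 * (((((n : ℕ) : ℝ) ^ α)⁻¹ * m⁻¹ ^ 2 + m⁻¹ ^ 2 * (2 * ω) * t) *
        Real.exp (2 * m⁻¹ * (B + 2 * ω) * t)) + (((n : ℕ) : ℝ) ^ α)⁻¹ := by
  have hN := rpow_pos α n
  have hphi : ∀ {v : ℝ}, 0 ≤ v → phiN α n v = ((n : ℕ) : ℝ) ^ α -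
    ((((n : ℕ) : ℝ) ^ α)⁻¹ + v)⁻¹ := fun hv => phiN_eq α n hv
  generalize ((n : ℕ) : ℝ) ^ α = N at hN hphi
  set δ := N⁻¹ with hδ
  have hδ0 : 0 < δ := inv_pos.2 hN
  have hT : 0 ≤ T := ht.1.trans ht.2
  have hB0 : 0 ≤ B := (abs_nonneg _).trans (hB 0 ⟨le_rfl, hT⟩ 0)
  have hUb : ∀ s, 0 ≤ s → ∀ x, U s x ∈ Set.Icc m K := fun s hs x =>
    mem_Icc_of_truncField hU.truncField (fun x => by rw [hU.initial, ← h0]; exact hmK _ _) hs x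
  have hVpos : ∀ s, 0 ≤ s → ∀ x, 0 < δ + U s x := fun s hs x => by linarith [(hUb s hs x).1]
  have hupos : ∀ s x, 0 < u s x := fun s x => hm.trans_le (hmK s x).1
  have hVinv : ∀ s, 0 ≤ s → ∀ x, (δ + U s x)⁻¹ ≤ m⁻¹ := fun s hs x =>
    inv_anti₀ hm (by linarith [(hUb s hs x).1])
  have huinv : ∀ s x, (u s x)⁻¹ ≤ m⁻¹ := fun s x => inv_anti₀ hm (hmK s x).1
  set W : ℝ → ZMod n → ℝ := fun s x => -(δ + U s x)⁻¹ with hW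
  set w : ℝ → ZMod n → ℝ := fun s x => -(u s (ZMod.toAddCircle x))⁻¹ with hw
  set E : ℝ → ZMod n → ℝ := fun s x => W s x - w s x with hE
  have hKE := abs_le_of_discrete_parabolic (n := n) (E := E) (T := T) (a := δ * m⁻¹ ^ 2)
    (b := m⁻¹ ^ 2 * (2 * ω)) (C := 2 * m⁻¹ * (B + 2 * ω)) (c := fun s x => W s x ^ 2)
    (E' := fun s x => W s x ^ 2 * discreteLaplacian n (W s) x -
      w s x ^ 2 * w2 s (ZMod.toAddCircle x))
    (by positivity) (by positivity) (by positivity) (fun x => ?_) (fun s hs x => ?_)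
    (fun s x => sq_nonneg _) (fun x => ?_) (fun s hs x => ?_) ht x
  · have hV := (hUb t ht.1 x).2
    have hu' := hmK t (ZMod.toAddCircle x)
    have hVp := hVpos t ht.1 x
    have hup := hupos t (ZMod.toAddCircle x)
    have e : δ + U t x - u t (ZMod.toAddCircle x) =
        (δ + U t x) * u t (ZMod.toAddCircle x) * E t x := by
      simp only [hE, hW, hw]
      field_simp
      ring
    have e2 : |U t x - u t (ZMod.toAddCircle x)| ≤
        |δ + U t x - u t (ZMod.toAddCircle x)| + δ := by
      rw [abs_le]
      constructor
      · linarith [neg_abs_le (δ + U t x - u t (ZMod.toAddCircle x))]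
      · linarith [le_abs_self (δ + U t x - u t (ZMod.toAddCircle x))]
    refine e2.trans ?_
    have e3 : (δ + U t x) * u t (ZMod.toAddCircle x) ≤ (K + δ) ^ 2 := by
      rw [sq]
      exact mul_le_mul (by linarith) (by linarith [hu'.2]) hup.le (by linarith)
    rw [e, abs_mul, abs_of_pos (by positivity)]
    gcongr
  · have hUc : ContinuousOn (fun s => U s x) (Set.Icc 0 T) := fun s hs =>
      ((hU.ode s hs.1 x).continuousWithinAt).mono Set.Icc_subset_Ici_self
    exact ((continuousOn_const.add hUc).inv₀ fun s hs => (hVpos s hs.1 x).ne').neg.sub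
      (((continuous_slice hu _).inv₀ fun s => (hupos s _).ne').neg.continuousOn)
  · have hd1 := (hU.ode s hs.1.le x).hasDerivAt (Ici_mem_nhds hs.1)
    have hLap : discreteLaplacian n (fun y => phiN α n (U s y)) x =
        discreteLaplacian n (W s) x := by
      have : ∀ y, phiN α n (U s y) = N + W s y := fun y => by
        rw [hphi (hU.nonneg s hs.1.le y)]
        simp only [hW]
        ring
      simp only [this, discreteLaplacian]
      ring
    rw [hLap] at hd1
    have hd2 := ((hd1.const_add δ).inv (hVpos s hs.1.le x).ne').neg
    have hd3 := ((heq s hs.1 (ZMod.toAddCircle x)).inv (hupos _ _).ne').neg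
    refine (hd2.sub hd3).congr_deriv ?_
    simp only [hW, hw]
    rw [neg_sq, neg_sq, inv_pow, inv_pow]
    ring
  · have hVp := hVpos 0 le_rfl x
    have hup := hupos 0 (ZMod.toAddCircle x)
    have hU0 : U 0 x = u 0 (ZMod.toAddCircle x) := by rw [hU.initial, h0]
    have e : E 0 x = δ * ((δ + U 0 x)⁻¹ * (u 0 (ZMod.toAddCircle x))⁻¹) := by
      simp only [hE, hW, hw]
      rw [hU0] at hVp ⊢
      field_simp
      ring
    rw [e, abs_of_nonneg (by positivity), sq]
    gcongr
    · linarith [(hUb 0 le_rfl x).1]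
    · exact (hmK _ _).1
  -- `W² Δ_n W - w² ∂ₓ²w = W² Δ_n E + (W + w) E Δ_n w + w² (Δ_n w - ∂ₓ²w)`
  · have hs' : s ∈ Set.Icc 0 T := ⟨hs.1.le, hs.2⟩
    have hcons : |discreteLaplacian n (w s) x - w2 s (ZMod.toAddCircle x)| ≤ 2 * ω :=
      abs_laplacian_sub_le hdw hdw1 n (hω s hs') x
    have hbd : |discreteLaplacian n (w s) x| ≤ B + 2 * ω := by
      have h1 := abs_le.1 hcons
      have h2 := abs_le.1 (hB s hs' (ZMod.toAddCircle x))
      rw [abs_le]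
      constructor <;> linarith
    have hWle : |W s x| ≤ m⁻¹ := by
      simp only [hW, abs_neg]
      rw [abs_of_pos (inv_pos.2 (hVpos s hs.1.le x))]
      exact hVinv s hs.1.le x
    have hwle : |w s x| ≤ m⁻¹ := by
      simp only [hw, abs_neg]
      rw [abs_of_pos (inv_pos.2 (hupos _ _))]
      exact huinv _ _
    have hsplit : W s x ^ 2 * discreteLaplacian n (W s) x -
        w s x ^ 2 * w2 s (ZMod.toAddCircle x) - W s x ^ 2 * discreteLaplacian n (E s) x =
        (W s x + w s x) * E s x * discreteLaplacian n (w s) x +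
        w s x ^ 2 * (discreteLaplacian n (w s) x - w2 s (ZMod.toAddCircle x)) := by
      have : discreteLaplacian n (E s) x =
        discreteLaplacian n (W s) x - discreteLaplacian n (w s) x := discreteLaplacian_sub n _ _ x
      rw [this]
      simp only [hE]
      ring
    rw [hsplit]
    refine (abs_add_le _ _).trans ?_
    rw [abs_mul, abs_mul, abs_mul, abs_pow]
    have hsum : |W s x + w s x| ≤ 2 * m⁻¹ := (abs_add_le _ _).trans (by linarith)
    calc _ ≤ 2 * m⁻¹ * |E s x| * (B + 2 * ω) + m⁻¹ ^ 2 * (2 * ω) := by gcongr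
      _ = _ := by ring

/-! ### Convergence -/

/-- The solution of the discrete system converges to a classical solution, uniformly on bounded
time intervals. -/
theorem eventually_abs_discrete_sub_le {α : ℝ} (hα : 0 < α) {u₀ : UnitAddCircle → ℝ}
    {U : (n : ℕ+) → ℝ → ZMod n → ℝ} (hU : ∀ n, IsDiscreteSolution α u₀ n (U n))
    {u w1 w2 : ℝ → UnitAddCircle → ℝ}
    (hu : Continuous (Function.uncurry u)) (hw2 : Continuous (Function.uncurry w2))
    (h0 : ∀ x, u 0 x = u₀ x)
    (hdw : HasSpaceDeriv (fun t x => -(u t x)⁻¹) w1) (hdw1 : HasSpaceDeriv w1 w2)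
    (heq : ∀ t, 0 < t → ∀ x, HasDerivAt (fun s => u s x) (w2 t x) t)
    {m K : ℝ} (hm : 0 < m) (hmK : ∀ t x, u t x ∈ Set.Icc m K) {T : ℝ} (hT : 0 ≤ T) {η : ℝ}
    (hη : 0 < η) :
    ∀ᶠ n : ℕ+ in atTop, ∀ x : ZMod n, ∀ t ∈ Set.Icc 0 T,
      |U n t x - u t (ZMod.toAddCircle x)| ≤ η := by
  obtain ⟨B, hB⟩ := ((isCompact_Icc (a := (0 : ℝ)) (b := T)).prod
    (isCompact_univ (X := UnitAddCircle))).exists_bound_of_continuousOn hw2.continuousOn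
  have hB' : ∀ t ∈ Set.Icc 0 T, ∀ x, |w2 t x| ≤ B := fun t ht x => hB (t, x) ⟨ht, trivial⟩
  have hB0 : 0 ≤ B := (abs_nonneg _).trans (hB' 0 ⟨le_rfl, hT⟩ 0)
  -- the error bound of `abs_discrete_sub_le` as a function of `δ = n ^ (-α)` and `ω`
  set Φ : ℝ × ℝ → ℝ := fun p => (K + p.1) ^ 2 * ((p.1 * m⁻¹ ^ 2 + m⁻¹ ^ 2 * (2 * p.2) * T) *
    Real.exp (2 * m⁻¹ * (B + 2 * p.2) * T)) + p.1 with hΦ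
  have hΦc : Continuous Φ := by fun_prop
  have hΦ0 : ∀ᶠ p in 𝓝 ((0 : ℝ), (0 : ℝ)), Φ p < η :=
    hΦc.continuousAt.eventually_lt continuousAt_const (by simpa [hΦ] using hη)
  rw [nhds_prod_eq] at hΦ0
  obtain ⟨P, hP, Q, hQ, hPQ⟩ := eventually_prod_iff.1 hΦ0
  obtain ⟨ω, hQω, hω⟩ := ((hQ.filter_mono nhdsWithin_le_nhds).and
    (self_mem_nhdsWithin (a := (0 : ℝ)) (s := Set.Ioi 0))).exists
  have hn : Tendsto (fun n : ℕ+ => ((n : ℕ) : ℝ)) atTop atTop :=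
    tendsto_natCast_atTop_atTop.comp tendsto_PNat_val_atTop_atTop
  have hδ : Tendsto (fun n : ℕ+ => (((n : ℕ) : ℝ) ^ α)⁻¹) atTop (𝓝 0) :=
    tendsto_inv_atTop_zero.comp ((tendsto_rpow_atTop hα).comp hn)
  obtain ⟨r, hr, hshift⟩ := Metric.eventually_nhds_iff.1 (eventually_abs_shift_sub_le hw2 T hω)
  filter_upwards [hδ.eventually hP, (tendsto_inv_atTop_zero.comp hn).eventually
    (gt_mem_nhds hr)] with n hn1 hn2 x t ht
  have key := abs_discrete_sub_le (hU n) hu h0 hdw hdw1 heq hm hmK hB' (le_of_lt hω)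
    (fun t ht x h hh => hshift (by
      rw [Real.dist_eq, sub_zero]; exact hh.trans_lt hn2) t ht x) ht x
  have hδ0 : 0 ≤ (((n : ℕ) : ℝ) ^ α)⁻¹ := by positivity
  have hω0 : 0 ≤ ω := le_of_lt hω
  have ht2 := ht.2
  have ht0 := ht.1
  refine key.trans (le_trans ?_ (hPQ hn1 hQω).le)
  simp only [hΦ]
  gcongr

/-- The classical solution of `exists_isClassicalSolution`, as a function on the circle. -/
theorem exists_circle_solution {u₀ : UnitAddCircle → ℝ}
    (hu₀ : ContDiff ℝ 2 (fun x : ℝ => u₀ (x : UnitAddCircle))) {ε : ℝ} (hε : 0 < ε)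
    (hlow : ∀ x, ε ≤ u₀ x) :
    ∃ (m K : ℝ) (u w1 w2 : ℝ → UnitAddCircle → ℝ), 0 < m ∧
      Continuous (Function.uncurry u) ∧ Continuous (Function.uncurry w1) ∧
      Continuous (Function.uncurry w2) ∧ (∀ t x, u t x ∈ Set.Icc m K) ∧ (∀ x, u 0 x = u₀ x) ∧
      HasSpaceDeriv u (fun t x => u t x ^ 2 * w1 t x) ∧ HasSpaceDeriv w1 w2 ∧
      ∀ t, 0 < t → ∀ x, HasDerivAt (fun s => u s x) (w2 t x) t := by
  obtain ⟨m, K, U, W1, W2, h, h0⟩ := exists_isClassicalSolution hu₀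
    (fun x => by simp only [AddCircle.coe_add, AddCircle.coe_period, add_zero]) hε
    (fun x => hlow x)
  refine ⟨m, K, fun t => (h.periodic_U t).lift, fun t => (h.periodic_W1 t).lift,
    fun t => (h.periodic_W2 t).lift, h.pos, continuous_uncurry_of_lift h.continuous_U,
    continuous_uncurry_of_lift h.continuous_W1, continuous_uncurry_of_lift h.continuous_W2,
    fun t x => ?_, fun x => ?_, h.deriv_U, h.deriv_W1, fun t ht x => ?_⟩
  · induction x using QuotientAddGroup.induction_on with
    | H y => exact h.mem_Icc t y
  · induction x using QuotientAddGroup.induction_on with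
    | H y => exact h0 y
  · induction x using QuotientAddGroup.induction_on with
    | H y => exact h.equation t ht y

end FastDiffusion

open FastDiffusion

theorem theorem2p2 (α : ℝ) (hα : 0 < α) (u₀ : UnitAddCircle → ℝ)
    (hu₀ : ContDiff ℝ 2 (fun x : ℝ => u₀ (x : UnitAddCircle)))
    (ε : ℝ) (hε : 0 < ε) (hlow : ∀ x, ε ≤ u₀ x) :
    ∃ (U : (n : ℕ+) → ℝ → ZMod n → ℝ) (u : ℝ → UnitAddCircle → ℝ),
      -- `U n` is the solution of the system of ODEs
      (∀ n, FastDiffusion.IsDiscreteSolution α u₀ n (U n) ∧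
        ∀ V, FastDiffusion.IsDiscreteSolution α u₀ n V → ∀ t, 0 ≤ t → V t = U n t) ∧
      -- `u` is the solution of the hydrodynamic equation, continuous and positive
      (ContinuousOn (Function.uncurry u) (Set.Ici 0 ×ˢ Set.univ) ∧
        (∀ t, 0 ≤ t → ∀ x, 0 < u t x) ∧ (∀ x, u 0 x = u₀ x) ∧
        ∀ S, 0 < S → FastDiffusion.IsEnergySolution S u₀ u ∧
          ∀ v, FastDiffusion.IsEnergySolution S u₀ v →
            ∀ᵐ z ∂(FastDiffusion.spaceTime S), v z.1 z.2 = u z.1 z.2) ∧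
      -- uniform convergence on some time interval
      ∃ T : ℝ, 0 < T ∧
        Tendsto (fun n : ℕ+ => ⨆ x : ZMod n, ⨆ t ∈ Set.Icc (0 : ℝ) T,
          ‖U n t x - u t (ZMod.toAddCircle x)‖ₑ) atTop (𝓝 0) := by
  obtain ⟨m, K, u, w1, w2, hm, hu, hw1, hw2, hmK, h0, hdu, hdw1, heq⟩ :=
    exists_circle_solution hu₀ hε hlow
  have hpos : ∀ t x, 0 < u t x := fun t x => hm.trans_le (hmK t x).1
  choose U hU using exists_isDiscreteSolution α (fun x => hε.le.trans (hlow x))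
  have hdw := HasSpaceDeriv.neg_inv hpos hdu
  have hsol : ∀ S, 0 < S → IsEnergySolution S u₀ u := fun S hS =>
    isEnergySolution_of_classical hS hu hw1 hw2 hpos h0 hdu hdw1 heq
  refine ⟨U, u, fun n => ⟨hU n, fun V hV t ht => (hU n).unique hV ht⟩,
    ⟨hu.continuousOn, fun t _ => hpos t, h0, fun S hS => ⟨hsol S hS, fun v hv =>
      (hsol S hS).ae_eq hS.le hv⟩⟩, 1, one_pos, ?_⟩
  rw [ENNReal.tendsto_nhds_zero]
  intro δ hδ
  obtain ⟨η, hη, hηδ⟩ := ENNReal.lt_iff_exists_nnreal_btwn.1 hδ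
  filter_upwards [eventually_abs_discrete_sub_le hα hU hu hw2 h0 hdw hdw1 heq hm hmK zero_le_one
    (η := η) (by exact_mod_cast hη)] with n hn
  refine iSup_le fun x => iSup₂_le fun t ht => le_trans ?_ hηδ.le
  rw [Real.enorm_eq_ofReal_abs]
  exact (ENNReal.ofReal_le_ofReal (hn x t ht)).trans_eq (ENNReal.ofReal_coe_nnreal)
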